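/- Let $k$ be an algebraically closed field of characteristic $p>0$, let $r\ge 1$ and $q=p^r$, and let $X$ be a smooth separated $k$-scheme of finite type, of pure dimension $1$. All sheaves below are sheaves on the small étale site of $X$, and stalks are étale stalks; $\mathcal O_X$ is the étale structure sheaf. A left $\mathcal O_{F^r,X}$-module is a sheaf $M$ of $\mathcal O_X$-modules with an additive endomorphism $F^r\colon M\to M$ such that $F^r(sm)=s^qF^r(m)$ for all local sections $s$ of $\mathcal O_X$ and $m$ of $M$. It is unit if it is quasi-coherent and its structural morphism $F^{r*}M\to M$, $s\otimes m\mapsto sF^r(m)$ (base change along the $q$-power Frobenius), is an isomorphism. It is locally finitely generated if for every affine open $U\subseteq X$ the module $M(U)$ is finitely generated over the twisted polynomial ring $\mathcal O_X(U)[F^r]$. It is torsion-free if over affine étale $X$-schemes no nonzero section of $M$ is annihilated by a nonzerodivisor. A root of $M$ is a coherent $\mathcal O_X$-submodule $M'\subseteq M$ that is contained in the $\mathcal O_X$-submodule of $M$ generated by $F^r(M')$ and that generates $M$ as a left $\mathcal O_{F^r,X}$-module. Similarly, for a commutative ring $A$ of characteristic $p$ and a left $A[F^r]$-module $W$ (an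 $A$-module with an additive endomorphism $F^r$ satisfying $F^r(aw)=a^qF^r(w)$), a root of $W$ is a finitely generated $A$-submodule $W_0\subseteq W$ that is contained in the $A$-span of $F^r(W_0)$ and that generates $W$ as a left $A[F^r]$-module. A minimal root is a root that is minimal with respect to inclusion. Theorem. Let $M$ be a torsion-free, locally finitely generated unit $\mathcal O_{F^r,X}$-module. Then $M$ has a unique minimal root $M_0$, and $M_0$ is contained in every root of $M$. Moreover, for every closed point $x$ of $X$, the stalk $(M_0)_x\subseteq M_x$ is the minimal root of the $\mathcal O_{X,x}[F^r]$-module $M_x$: it is a root of $M_x$, and it is contained in every root of $M_x$. -/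

import Mathlib

open CategoryTheory AlgebraicGeometry Limits Opposite

universe u

noncomputable section

namespace FrobMod

/-- Smooth morphisms of relative dimension `1` are locally of finite type. -/
instance locallyOfFiniteType_of_smooth {X Y : Scheme.{u}} (f : X ⟶ Y)
    [SmoothOfRelativeDimension 1 f] : LocallyOfFiniteType f :=
  have : Smooth f := SmoothOfRelativeDimension.smooth 1 f
  inferInstance

/-! ## The structure sheaf of the small étale site -/

/-- The étale structure presheaf of `X`: it sends an étale `X`-scheme `U` to `Γ(U, 𝒪_U)`. -/
abbrev etaleO (X : Scheme.{u}) : (Scheme.Etale X)ᵒᵖ ⥤ CommRingCat.{u} :=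
  (Scheme.Etale.forget X ⋙ Over.forget X).op ⋙ Scheme.Γ

/-- A presheaf of rings is a sheaf as soon as its presheaf of underlying sets is one. -/
lemma isSheaf_of_isSheaf_forget {C : Type*} [Category* C] (J : GrothendieckTopology C)
    (G : Cᵒᵖ ⥤ RingCat.{u}) (h : Presieve.IsSheaf J (G ⋙ forget RingCat.{u})) :
    Presheaf.IsSheaf J G := by
  intro E X S hS x hx
  have key : ∀ e : E, Presieve.FamilyOfElements.Compatible (P := G ⋙ forget RingCat.{u})
      (fun Y f hf => (x f hf).hom e) := by
    intro e Y₁ Y₂ Z g₁ g₂ f₁ f₂ h₁ h₂ hc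
    exact congr($(hx g₁ g₂ h₁ h₂ hc).hom e)
  choose t ht hu using fun e => h S hS _ (key e)
  have hres : ∀ e ⦃Y⦄ (f : Y ⟶ X) (hf : S f), (G.map f.op).hom (t e) = (x f hf).hom e :=
    fun e Y f hf => ht e f hf
  have hsep : ∀ a b : G.obj (op X),
      (∀ ⦃Y⦄ (f : Y ⟶ X), S f → (G.map f.op).hom a = (G.map f.op).hom b) → a = b :=
    fun a b hab => (h S hS).isSeparatedFor.ext (fun Y f hf => hab f hf)
  let φ : E →+* G.obj (op X) :=
    { toFun := t
      map_one' := hsep _ _ fun Y f hf => by rw [hres _ f hf, map_one, map_one]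
      map_mul' := fun a b => hsep _ _ fun Y f hf => by
        rw [hres _ f hf, map_mul, map_mul, hres _ f hf, hres _ f hf]
      map_zero' := hsep _ _ fun Y f hf => by rw [hres _ f hf, map_zero, map_zero]
      map_add' := fun a b => hsep _ _ fun Y f hf => by
        rw [hres _ f hf, map_add, map_add, hres _ f hf, hres _ f hf] }
  refine ⟨RingCat.ofHom φ, fun Y f hf => ?_, fun ψ hψ => ?_⟩
  · exact RingCat.hom_ext (RingHom.ext fun e => hres e f hf)
  · exact RingCat.hom_ext (RingHom.ext fun e =>
      hu e (ψ.hom e) fun Y f hf => congr($(hψ f hf).hom e))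

/-- Global functions are represented by the affine line. -/
def gammaRepresentableBy :
    (Scheme.Γ.{u} ⋙ forget CommRingCat.{u}).RepresentableBy
      (Spec (CommRingCat.of (MvPolynomial PUnit.{u + 1} (ULift.{u} ℤ)))) where
  homEquiv {X} := (ΓSpec.adjunction.homEquiv X (op _)).symm.trans
    ((opEquiv _ _).trans
      { toFun := fun φ => φ.hom (MvPolynomial.X PUnit.unit)
        invFun := fun a => CommRingCat.ofHom (MvPolynomial.eval₂Hom
          ((Int.castRingHom _).comp (ULift.ringEquiv.toRingHom)) (fun _ => a))
        left_inv := fun φ => by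
          ext1
          apply MvPolynomial.ringHom_ext'
          · have : ∀ f g : ULift.{u} ℤ →+* Γ(X, ⊤), f = g := fun f g => by
              have := RingHom.ext_int
                (f.comp (ULift.ringEquiv (R := ℤ)).symm.toRingHom)
                (g.comp (ULift.ringEquiv (R := ℤ)).symm.toRingHom)
              ext x
              exact congr($this x.down)
            apply this
          · intro i
            exact MvPolynomial.eval₂Hom_X' _ _ _
        right_inv := fun a => MvPolynomial.eval₂Hom_X' _ _ _ })
  homEquiv_comp f g := by
    have := ΓSpec.adjunction.homEquiv_naturality_left_symm f g
    simp only [Equiv.trans_apply, this]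
    rfl

lemma isContinuous_over_forget (P : MorphismProperty Scheme.{u}) [P.IsMultiplicative]
    [P.IsStableUnderBaseChange] [P.HasOfPostcompProperty P] (X : Scheme.{u}) :
    Functor.IsContinuous (MorphismProperty.Over.forget P ⊤ X)
      (X.smallGrothendieckTopology (P := P) (Q := P)) (X.overGrothendieckTopology P) := by
  have : RepresentablyFlat (MorphismProperty.Over.forget P ⊤ X) := flat_of_preservesFiniteLimits _
  rw [Functor.isContinuous_iff_coverPreserving]
  exact Functor.coverPreserving_restrictedTopology _ _

lemma isContinuous_etale_forget (X : Scheme.{u}) :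
    Functor.IsContinuous (Scheme.Etale.forget X) X.smallEtaleTopology
      (Scheme.etaleTopology.over X) :=
  isContinuous_over_forget @Etale X

/-- The étale structure sheaf of `X`. -/
abbrev etaleSheaf (X : Scheme.{u}) : Sheaf X.smallEtaleTopology RingCat.{u} where
  obj := etaleO X ⋙ forget₂ CommRingCat.{u} RingCat.{u}
  property := by
    apply isSheaf_of_isSheaf_forget
    have := isContinuous_etale_forget X
    have : Functor.IsContinuous (Scheme.Etale.forget X ⋙ Over.forget X) X.smallEtaleTopology
        Scheme.etaleTopology :=
      Functor.isContinuous_comp _ _ _ (Scheme.etaleTopology.over X) _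
    have : (Scheme.Γ.{u} ⋙ forget CommRingCat.{u}).IsRepresentable := ⟨_, ⟨gammaRepresentableBy⟩⟩
    have : Scheme.etaleTopology.{u}.Subcanonical := .of_le
      (Scheme.etaleTopology_le_proetaleTopology.trans Scheme.proetaleTopology_le_fpqcTopology)
    exact Functor.op_comp_isSheaf_of_isSheaf_type (Scheme.Etale.forget X ⋙ Over.forget X)
      X.smallEtaleTopology (K := Scheme.etaleTopology) (G := Scheme.Γ.{u} ⋙ forget CommRingCat.{u})
      (GrothendieckTopology.Subcanonical.isSheaf_of_isRepresentable _)

/-! ## Algebra of Frobenius-linear maps -/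

section Algebra

/-- A semilinear map `g : W → W'` along a ring map `φ : A → B` exhibits `W'` as the base change of
`W`: the induced `B`-linear map `B ⊗_{A, φ} W → W'` is an isomorphism. -/
def IsBaseChangeAlong {A B : Type*} [CommRing A] [CommRing B] (φ : A →+* B)
    {W W' : Type*} [AddCommGroup W] [Module A W] [AddCommGroup W'] [Module B W']
    (g : W →+ W') (hg : ∀ (a : A) (w : W), g (a • w) = φ a • g w) : Prop :=
  letI : Algebra A B := φ.toAlgebra
  letI : Module A W' := Module.compHom W' φ
  haveI : IsScalarTower A B W' := ⟨fun a b w => mul_smul (φ a) b w⟩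
  IsBaseChange B ({ g with map_smul' := hg } : W →ₗ[A] W')

/-- The `r`-th Frobenius endomorphism `a ↦ a ^ (p ^ r)` of a (possibly zero) ring in which the
prime `p` vanishes. -/
def frob (p r : ℕ) [hp : Fact p.Prime] (A : Type*) [CommRing A] (h : (p : A) = 0) : A →+* A where
  toFun a := a ^ p ^ r
  map_one' := one_pow _
  map_mul' a b := mul_pow a b _
  map_zero' := zero_pow (pow_ne_zero _ hp.out.ne_zero)
  map_add' a b := by
    cases subsingleton_or_nontrivial A
    · exact Subsingleton.elim _ _
    · have : CharP A p := by
        obtain ⟨n, hn⟩ := CharP.exists A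
        have h1 : n ∣ p := (CharP.cast_eq_zero_iff A n p).1 h
        rcases (Nat.dvd_prime hp.out).1 h1 with rfl | rfl
        · exact absurd (by rw [← Nat.cast_one, CharP.cast_eq_zero A 1]) (one_ne_zero (α := A))
        · exact hn
      exact add_pow_char_pow a b p r

variable {A : Type*} [Ring A] {W : Type*} [AddCommGroup W] [Module A W] (F : W →+ W)

/-- The smallest `A`-submodule of `W` which contains `S` and is stable under `F`, that is, the left
`A[F]`-submodule generated by `S`. -/
def frobSpan (S : Set W) : Submodule A W :=
  sInf {N | S ⊆ N ∧ ∀ w ∈ N, F w ∈ N}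

/-- `W` is finitely generated as a left `A[F]`-module. -/
def IsFrobFG : Prop := ∃ s : Finset W, frobSpan (A := A) F s = ⊤

/-- `W₀` is a root of the `A`-module `W` with Frobenius-linear endomorphism `F`. -/
structure IsRoot (W₀ : Submodule A W) : Prop where
  fg : W₀.FG
  le_span : W₀ ≤ Submodule.span A (F '' W₀)
  frobSpan_eq_top : frobSpan (A := A) F W₀ = ⊤

end Algebra

/-! ## Modules over the étale structure sheaf -/

section Presheaf

variable {X : Scheme.{u}}
  (P : PresheafOfModules.{u} (etaleO X ⋙ forget₂ CommRingCat.{u} RingCat.{u}))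

/-- The module of sections of `P` over an étale `X`-scheme `U`. -/
abbrev Sec (U : X.Etale) : Type u := P.obj (op U)

/-- The restriction map `P(U) → P(V)` along a morphism `V ⟶ U` of étale `X`-schemes. -/
def res {U V : X.Etale} (g : V ⟶ U) : Sec P U →+ Sec P V :=
  (P.presheaf.map g.op).hom

lemma res_smul {U V : X.Etale} (g : V ⟶ U) (a : (etaleO X).obj (op U)) (m : Sec P U) :
    res P g (a • m) = ((etaleO X).map g.op).hom a • res P g m :=
  P.map_smul g.op a m

/-- Quasi-coherence of an étale sheaf of `𝒪_X`-modules: for every morphism `V ⟶ U` of affine étale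
`X`-schemes the natural map `Γ(V, 𝒪_V) ⊗ P(U) → P(V)` is an isomorphism. In other words, the
restriction of `P` to every `U` is the étale sheaf associated with a quasi-coherent module. -/
def IsQuasicoherent : Prop :=
  ∀ ⦃U V : X.Etale⦄ (g : V ⟶ U), IsAffine U.left → IsAffine V.left →
    IsBaseChangeAlong ((etaleO X).map g.op).hom (res P g) (res_smul P g)

/-- Coherence over a locally noetherian scheme: `P` is quasi-coherent and its sections over every
affine étale `X`-scheme form a finitely generated module. -/
structure IsCoherent : Prop where
  quasicoherent : IsQuasicoherent P
  finite (U : X.Etale) : IsAffine U.left → Module.Finite ((etaleO X).obj (op U)) (Sec P U)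

/-- `P` is torsion-free: a section over an affine étale `X`-scheme which is killed by a
nonzerodivisor is zero. -/
def IsTorsionFree : Prop :=
  ∀ U : X.Etale, IsAffine U.left → Module.IsTorsionFree ((etaleO X).obj (op U)) (Sec P U)

/-- A family of submodules of `P` which is stable under restriction is a subsheaf if membership is
local for the étale topology. -/
def IsSubsheaf {P : PresheafOfModules.{u} (etaleO X ⋙ forget₂ CommRingCat.{u} RingCat.{u})}
    (N : P.Submodule) : Prop :=
  ∀ (U : X.Etale) (m : Sec P U) (S : Sieve U), S ∈ X.smallEtaleTopology U →
    (∀ (V : X.Etale) (g : V ⟶ U), S g → res P g m ∈ N.obj (op V)) → m ∈ N.obj (op U)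

/-- The action of an additive endomorphism of `P` on sections over `U`. -/
def onSec (F : P.presheaf ⟶ P.presheaf) (U : X.Etale) : Sec P U →+ Sec P U :=
  (F.app (op U)).hom

end Presheaf

/-! ## Left `𝒪_{F^r, X}`-modules -/

/-- A left `𝒪_{F^r, X}`-module on the small étale site of `X`, where `q = p ^ r`: a sheaf of
modules over the étale structure sheaf with an additive endomorphism `F` such that
`F (s • m) = s ^ q • F m`. -/
structure OFModule (X : Scheme.{u}) (q : ℕ) where
  /-- the underlying sheaf of `𝒪_X`-modules -/
  sheaf : SheafOfModules.{u} (etaleSheaf X)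
  /-- the action of `F^r` -/
  F : sheaf.val.presheaf ⟶ sheaf.val.presheaf
  F_smul (U : X.Etale) (s : (etaleO X).obj (op U)) (m : Sec sheaf.val U) :
    onSec sheaf.val F U (s • m) = s ^ q • onSec sheaf.val F U m

namespace OFModule

variable {X : Scheme.{u}} {q : ℕ} (M : OFModule X q)

/-- The underlying presheaf of modules. -/
abbrev psh : PresheafOfModules.{u} (etaleO X ⋙ forget₂ CommRingCat.{u} RingCat.{u}) :=
  M.sheaf.val

/-- The action of `F^r` on sections over `U`. -/
def frobSec (U : X.Etale) : Sec M.psh U →+ Sec M.psh U :=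
  onSec M.psh M.F U

lemma frobSec_smul (U : X.Etale) (s : (etaleO X).obj (op U)) (m : Sec M.psh U) :
    M.frobSec U (s • m) = s ^ q • M.frobSec U m :=
  M.F_smul U s m

/-- The sheaf of `𝒪_X`-submodules of `M` generated by `F^r(N)`. -/
def spanFrob (N : M.psh.Submodule) : M.psh.Submodule :=
  sInf {N' | IsSubsheaf N' ∧ ∀ (U : X.Etale), ∀ m ∈ N.obj (op U), M.frobSec U m ∈ N'.obj (op U)}

/-- The sheaf of left `𝒪_{F^r, X}`-submodules of `M` generated by `N`. -/
def generated (N : M.psh.Submodule) : M.psh.Submodule :=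
  sInf {N' | IsSubsheaf N' ∧ N ≤ N' ∧
    ∀ (U : X.Etale), ∀ m ∈ N'.obj (op U), M.frobSec U m ∈ N'.obj (op U)}

/-- `N` is a root of `M`: a coherent sheaf of `𝒪_X`-submodules which is contained in the
`𝒪_X`-submodule generated by `F^r(N)` and which generates `M` as a left `𝒪_{F^r, X}`-module. -/
structure IsRoot (N : M.psh.Submodule) : Prop where
  isSubsheaf : IsSubsheaf N
  coherent : IsCoherent N.toPresheafOfModules
  le_spanFrob : N ≤ M.spanFrob N
  generated_eq_top : M.generated N = ⊤

/-- `M` is locally finitely generated: for every affine open `U ⊆ X`, `M(U)` is a finitely generated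
left `Γ(U, 𝒪_X)[F^r]`-module. -/
def IsLocallyFG : Prop :=
  ∀ U : X.Opens, IsAffineOpen U →
    FrobMod.IsFrobFG (A := (etaleO X).obj (op (Scheme.Etale.mk U.ι)))
      (M.frobSec (Scheme.Etale.mk U.ι))

end OFModule

lemma natCast_eq_zero {X : Scheme.{u}} {k : Type u} [Field k] (p : ℕ) [CharP k p]
    (f : X ⟶ Spec (.of k)) (U : X.Etale) : ((p : ℕ) : (etaleO X).obj (op U)) = 0 := by
  let φ : k →+* Γ(U.left, ⊤) := ((Scheme.ΓSpecIso (.of k)).inv ≫ (U.hom ≫ f).appTop).hom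
  have h : φ (p : k) = 0 := by rw [CharP.cast_eq_zero, map_zero]
  rw [map_natCast] at h
  exact h

/-- A unit `𝒪_{F^r, X}`-module over a scheme `X` of characteristic `p`: it is quasi-coherent and the
structural morphism `F^{r*} M → M` is an isomorphism, i.e. for every affine étale `X`-scheme `U` the
natural map from the base change of `M(U)` along the `r`-th Frobenius of `Γ(U, 𝒪_U)` to `M(U)` is an
isomorphism. -/
structure OFModule.IsUnit {X : Scheme.{u}} {k : Type u} [Field k] {p r : ℕ} [Fact p.Prime]
    [CharP k p] (f : X ⟶ Spec (.of k)) (M : OFModule X (p ^ r)) : Prop where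
  quasicoherent : IsQuasicoherent M.psh
  bijective (U : X.Etale) : IsAffine U.left →
    IsBaseChangeAlong (frob p r _ (natCast_eq_zero p f U)) (M.frobSec U) (M.frobSec_smul U)

/-! ## Étale stalks -/

namespace OFModule

variable {X : Scheme.{u}} {Ω : Type u} [Field Ω] [IsSepClosed Ω] (x : Spec (.of Ω) ⟶ X)
  {q : ℕ} (M : OFModule X q)

/-- The étale stalk `𝒪_{X, x}` at a geometric point. -/
abbrev stalkRing : RingCat.{u} :=
  (Scheme.pointSmallEtale x).presheafFiber.obj (etaleSheaf X).obj

/-- The restriction of `M` to the category of étale neighbourhoods of `x`. -/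
def nbhd : PresheafOfModules.{u}
    ((CategoryOfElements.π (Scheme.pointSmallEtale x).fiber).op ⋙ (etaleSheaf X).obj) :=
  (PresheafOfModules.pushforward₀ (CategoryOfElements.π (Scheme.pointSmallEtale x).fiber)
    (etaleSheaf X).obj).obj M.psh

/-- The colimit cocone defining the underlying abelian group of the stalk of `M`. -/
def stalkCocone : Cocone (M.nbhd x).presheaf :=
  (Scheme.pointSmallEtale x).presheafFiberCocone M.psh.presheaf

/-- The cocone `M.stalkCocone x` is a colimit cocone. -/
def isColimitStalkCocone : IsColimit (M.stalkCocone x) :=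
  (Scheme.pointSmallEtale x).isColimitPresheafFiberCocone M.psh.presheaf

/-- The étale stalk `M_x`, the filtered colimit of the modules `M(U)` over the étale
neighbourhoods `U` of `x`, with its structure of `𝒪_{X, x}`-module. -/
abbrev stalk : Type u :=
  PresheafOfModules.ModuleColimit
    ((Scheme.pointSmallEtale x).isColimitPresheafFiberCocone (etaleSheaf X).obj)
    (M.isColimitStalkCocone x)

instance : Module (stalkRing x) (M.stalk x) :=
  inferInstanceAs (Module
    ((Scheme.pointSmallEtale x).presheafFiberCocone (etaleSheaf X).obj).pt (M.stalk x))

/-- The germ at `x` of a section of `M` over an étale neighbourhood `(U, v)` of `x`. -/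
def germ {U : X.Etale} (v : (Scheme.pointSmallEtale x).fiber.obj U) : Sec M.psh U →+ M.stalk x :=
  ((Scheme.pointSmallEtale x).toPresheafFiber U v M.psh.presheaf).hom

/-- The action of `F^r` on the stalk. -/
def stalkFrob : M.stalk x →+ M.stalk x :=
  ((Scheme.pointSmallEtale x).presheafFiber.map M.F).hom

/-- The germ at `x` of a section of the structure sheaf over an étale neighbourhood. -/
def germRing {U : X.Etale} (v : (Scheme.pointSmallEtale x).fiber.obj U) :
    (etaleO X).obj (op U) →+* stalkRing x :=
  ((Scheme.pointSmallEtale x).toPresheafFiber U v (etaleSheaf X).obj).hom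

lemma germ_smul {U : X.Etale} (v : (Scheme.pointSmallEtale x).fiber.obj U)
    (s : (etaleO X).obj (op U)) (m : Sec M.psh U) :
    M.germ x v (s • m) = germRing x v s • M.germ x v m :=
  (PresheafOfModules.ModuleColimit.smul_eq
    ((Scheme.pointSmallEtale x).isColimitPresheafFiberCocone (etaleSheaf X).obj)
    (M.isColimitStalkCocone x) (U := op (Functor.elementsMk _ U v)) s m).symm

lemma germ_res {U V : X.Etale} (g : V ⟶ U) (v : (Scheme.pointSmallEtale x).fiber.obj V)
    (m : Sec M.psh U) :
    M.germ x v (res M.psh g m) = M.germ x ((Scheme.pointSmallEtale x).fiber.map g v) m :=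
  congr($((Scheme.pointSmallEtale x).toPresheafFiber_w g v M.psh.presheaf).hom m)

lemma stalkFrob_germ {U : X.Etale} (v : (Scheme.pointSmallEtale x).fiber.obj U)
    (m : Sec M.psh U) : M.stalkFrob x (M.germ x v m) = M.germ x v (M.frobSec U m) :=
  congr($((Scheme.pointSmallEtale x).toPresheafFiber_naturality M.F U v).hom m)

/-- The stalk at `x` of a family of submodules of `M` stable under restriction, as a submodule of
the stalk `M_x`: it consists of the germs of the sections of `N`. -/
def stalkSubmodule (N : M.psh.Submodule) : Submodule (stalkRing x) (M.stalk x) where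
  carrier := {w | ∃ (U : X.Etale) (v : (Scheme.pointSmallEtale x).fiber.obj U),
    ∃ m ∈ N.obj (op U), M.germ x v m = w}
  zero_mem' := by
    obtain ⟨⟨U, v⟩⟩ := IsCofiltered.nonempty (C := (Scheme.pointSmallEtale x).fiber.Elements)
    exact ⟨U, v, 0, (N.obj (op U)).zero_mem, map_zero _⟩
  add_mem' := by
    rintro _ _ ⟨U, v, m, hm, rfl⟩ ⟨U', v', m', hm', rfl⟩
    obtain ⟨⟨W, w⟩, ⟨g, hg⟩, ⟨g', hg'⟩, -⟩ :=
      IsCofilteredOrEmpty.cone_objs (C := (Scheme.pointSmallEtale x).fiber.Elements)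
        ⟨U, v⟩ ⟨U', v'⟩
    refine ⟨W, w, res M.psh g m + res M.psh g' m',
      (N.obj (op W)).add_mem (N.map g.op hm) (N.map g'.op hm'), ?_⟩
    rw [map_add, germ_res, germ_res]
    dsimp at hg hg'
    rw [hg, hg']
  smul_mem' := by
    rintro s _ ⟨U, v, m, hm, rfl⟩
    obtain ⟨⟨⟨U', v'⟩⟩, s, rfl⟩ := PresheafOfModules.ModuleColimit.ιR_jointly_surjective
      ((Scheme.pointSmallEtale x).isColimitPresheafFiberCocone (etaleSheaf X).obj) s
    obtain ⟨⟨W, w⟩, ⟨g, hg⟩, ⟨g', hg'⟩, -⟩ :=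
      IsCofilteredOrEmpty.cone_objs (C := (Scheme.pointSmallEtale x).fiber.Elements)
        ⟨U, v⟩ ⟨U', v'⟩
    dsimp at hg hg'
    have hs : germRing x w (((etaleO X).map g'.op).hom s) = germRing x v' s := by
      rw [← hg']
      exact congr($((Scheme.pointSmallEtale x).toPresheafFiber_w g' w (etaleSheaf X).obj).hom s)
    refine ⟨W, w, ((etaleO X).map g'.op).hom s • res M.psh g m,
      (N.obj (op W)).smul_mem _ (N.map g.op hm), ?_⟩
    rw [germ_smul, germ_res, hg, hs]
    rfl

end OFModule

end FrobMod

end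

noncomputable section

namespace FrobMod

/-! ## Minimal roots of Frobenius modules -/

section MinimalRoots

variable {A : Type*} [Ring A] {W : Type*} [AddCommGroup W] [Module A W] {F : W →+ W}

/-! Write `spanF J` for the submodule generated by `F(J)`. Locally a smooth curve is étale over the
affine line, with coordinate `x`. Over a perfect field the powers `x ^ i`, `i < q`, form a basis of
the polynomial ring over its `q`-th powers, and this persists along étale maps because the relative
Frobenius of an étale map is an isomorphism (`bijective_sum_pow_mul_pow_of_etale`). For a unit
module, each section `w` is therefore uniquely `∑ x ^ i • F (w i)`, and `w ∈ spanF J` exactly when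
all `w i ∈ J` (`FrobCoord.mem_spanF_iff`). Hence every `N` has a least `I N` with `N ≤ spanF (I N)`,
generated by the coefficients of its elements.

If `N` is a root, then `I N` is a smaller root, and iterating gives a descending chain of roots. On
a curve, `F(N)` lies in `N` up to a nonzero denominator `t`, by comparing ranks over the polynomial
ring. From `q ≥ 2` it follows that the whole chain contains `t • N`; since `N / tN` is artinian, the
chain stops at some `N₀` with `I N₀ = N₀` (`FrobCoord.exists_isMinRoot`). Such an `N₀` satisfies `N₀
≤ spanF J → N₀ ≤ J` for every `J`. The iterates of `spanF` on a root `J` exhaust the module and `N₀`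
is finitely generated, so `N₀` lies in one of them, and hence in `J`.

This implication, the second half of `IsMinRoot`, passes to any base change that keeps the
coordinate (`IsMinRoot.baseChange`). Together with uniqueness it makes the local minimal roots
compatible with restriction. Flat descent (`mem_of_cover`) glues them to a coherent subsheaf, and
comparison with any other root is local. The germ map is again a base change that keeps the
coordinate (`frobCoord_stalk`), so the same argument identifies the stalks. -/

lemma subset_frobSpan (S : Set W) : S ⊆ frobSpan (A := A) F S := fun w hw => by
  simp only [frobSpan, SetLike.mem_coe, Submodule.mem_sInf]
  exact fun N hN => hN.1 hw

lemma frobSpan_le {S : Set W} {N : Submodule A W} (hS : S ⊆ N) (hN : ∀ w ∈ N, F w ∈ N) :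
    frobSpan F S ≤ N := sInf_le ⟨hS, hN⟩

lemma map_mem_frobSpan {S : Set W} {w : W} (hw : w ∈ frobSpan (A := A) F S) :
    F w ∈ frobSpan (A := A) F S := by
  simp only [frobSpan, Submodule.mem_sInf] at hw ⊢
  exact fun N hN => hN.2 _ (hw N hN)

lemma frobSpan_mono {S T : Set W} (h : S ⊆ T) : frobSpan (A := A) F S ≤ frobSpan F T :=
  frobSpan_le (h.trans (subset_frobSpan T)) fun _ => map_mem_frobSpan

variable (F) in
/-- The `A`-submodule generated by `F(J)`. -/
def spanF (J : Submodule A W) : Submodule A W := Submodule.span A (F '' J)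

lemma spanF_mono {J J' : Submodule A W} (h : J ≤ J') : spanF F J ≤ spanF F J' :=
  Submodule.span_mono (Set.image_mono h)

lemma mem_spanF {J : Submodule A W} {w : W} (h : w ∈ J) : F w ∈ spanF F J :=
  Submodule.subset_span ⟨w, h, rfl⟩

lemma spanF_le_frobSpan {J : Submodule A W} {S : Set W} (h : J ≤ frobSpan F S) :
    spanF F J ≤ frobSpan F S :=
  Submodule.span_le.2 <| by rintro _ ⟨w, hw, rfl⟩; exact map_mem_frobSpan (h hw)

variable (F) in
/-- A root `N` which is contained in every submodule `J` such that `N` lies in the span of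
`F(J)`. -/
def IsMinRoot (N : Submodule A W) : Prop :=
  IsRoot F N ∧ ∀ J : Submodule A W, N ≤ spanF F J → N ≤ J

lemma iterate_spanF_le {N J : Submodule A W} (hN : ∀ J : Submodule A W, N ≤ spanF F J → N ≤ J)
    (n : ℕ) (h : N ≤ (spanF F)^[n] J) : N ≤ J := by
  induction n with
  | zero => exact h
  | succ n ih => exact ih (hN _ (by rwa [Function.iterate_succ_apply'] at h))

/-- The iterates of `spanF` on a root increase, and their union is an `F`-stable submodule
containing the root, hence everything. A finitely generated submodule is compact in the lattice, so
one iterate contains it. -/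
lemma IsRoot.le_iterate_of_fg {N J : Submodule A W} (hJ : IsRoot F J) (hN : N.FG) :
    ∃ n, N ≤ (spanF F)^[n] J := by
  have hmono : Monotone fun n => (spanF F)^[n] J := by
    refine monotone_nat_of_le_succ fun n => ?_
    induction n with
    | zero => exact hJ.le_span
    | succ n ih => simp only [Function.iterate_succ_apply'] at ih ⊢; exact spanF_mono ih
  have hdir := hmono.directed_le
  have htop : ⨆ n, (spanF F)^[n] J = ⊤ := by
    rw [eq_top_iff, ← hJ.frobSpan_eq_top]
    refine frobSpan_le (le_iSup (fun n => (spanF F)^[n] J) 0) fun w hw => ?_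
    obtain ⟨n, hn⟩ := (Submodule.mem_iSup_of_directed _ hdir).1 hw
    refine (Submodule.mem_iSup_of_directed _ hdir).2 ⟨n + 1, ?_⟩
    rw [Function.iterate_succ_apply']
    exact mem_spanF hn
  obtain ⟨_, ⟨n, rfl⟩, hn⟩ := (CompleteLattice.isCompactElement_iff_le_of_directed_sSup_le _ _).1
    ((Submodule.fg_iff_compact N).1 hN) (Set.range fun n => (spanF F)^[n] J)
    (Set.range_nonempty _) hdir.directedOn_range (by rw [sSup_range, htop]; exact le_top)
  exact ⟨n, hn⟩

lemma IsMinRoot.le {N J : Submodule A W} (hN : IsMinRoot F N) (hJ : IsRoot F J) : N ≤ J :=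
  have ⟨n, hn⟩ := hJ.le_iterate_of_fg hN.1.fg
  iterate_spanF_le hN.2 n hn

lemma IsMinRoot.unique {N N' : Submodule A W} (hN : IsMinRoot F N) (hN' : IsMinRoot F N') :
    N = N' :=
  le_antisymm (hN.le hN'.1) (hN'.le hN.1)

variable (F) in
/-- A Frobenius coordinate for `F`: the powers `x ^ i` with `i < q` generate `A` over its `q`-th
powers, and each element of `W` is uniquely of the form `∑ x ^ i • F (w i)`. -/
structure FrobCoord (q : ℕ) (x : A) : Prop where
  map_smul : ∀ (a : A) (w : W), F (a • w) = a ^ q • F w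
  span : ∀ a : A, ∃ b : Fin q → A, a = ∑ i : Fin q, x ^ (i : ℕ) * b i ^ q
  bij : Function.Bijective fun w : Fin q → W => ∑ i : Fin q, x ^ (i : ℕ) • F (w i)

namespace FrobCoord

variable {q : ℕ} {x : A} (h : FrobCoord F q x)

include h

lemma exists_of_mem_spanF {J : Submodule A W} {w : W} (hw : w ∈ spanF F J) :
    ∃ u : Fin q → W, (∀ i, u i ∈ J) ∧ w = ∑ i : Fin q, x ^ (i : ℕ) • F (u i) := by
  induction hw using Submodule.span_induction with
  | mem w hw =>
    obtain ⟨v, hv, rfl⟩ := hw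
    -- From `1 = ∑ x ^ i * b i ^ q` one gets `F v = ∑ x ^ i • F (b i • v)`.
    obtain ⟨b, hb⟩ := h.span 1
    refine ⟨fun i => b i • v, fun i => J.smul_mem _ hv, ?_⟩
    simp only [h.map_smul, ← mul_smul, ← Finset.sum_smul, ← hb, one_smul]
  | zero => exact ⟨0, fun i => J.zero_mem, by simp⟩
  | add v w _ _ hv hw =>
    obtain ⟨a, ha, rfl⟩ := hv
    obtain ⟨b, hb, rfl⟩ := hw
    exact ⟨a + b, fun i => J.add_mem (ha i) (hb i), by simp [Finset.sum_add_distrib]⟩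
  | smul a w _ hw =>
    obtain ⟨u, hu, rfl⟩ := hw
    -- Expanding `a * x ^ i = ∑ j, x ^ j * b i j ^ q` and moving the `q`-th powers inside `F` brings
    -- `a • w` back to normal form.
    choose b hb using fun i : Fin q => h.span (a * x ^ (i : ℕ))
    refine ⟨fun j => ∑ i, b i j • u i, fun j => J.sum_mem fun i _ => J.smul_mem _ (hu i), ?_⟩
    simp only [Finset.smul_sum, ← mul_smul, map_sum, h.map_smul]
    rw [Finset.sum_comm]
    refine Finset.sum_congr rfl fun i _ => ?_
    rw [← Finset.sum_smul, ← hb]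

lemma mem_spanF_iff {J : Submodule A W} (u : Fin q → W) :
    ∑ i : Fin q, x ^ (i : ℕ) • F (u i) ∈ spanF F J ↔ ∀ i, u i ∈ J := by
  refine ⟨fun hw => ?_, fun hu => Submodule.sum_mem _ fun i _ =>
    Submodule.smul_mem _ _ (mem_spanF (hu i))⟩
  obtain ⟨v, hv, he⟩ := h.exists_of_mem_spanF hw
  rw [h.bij.1 he]
  exact hv

lemma map_mem_spanF_iff (hq : 0 < q) {J : Submodule A W} {w : W} :
    F w ∈ spanF F J ↔ w ∈ J := by
  have : NeZero q := ⟨hq.ne'⟩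
  -- The expansion of `F w` itself is `x ^ 0 • F w`, so its coefficients are `w, 0, …, 0`.
  have := h.mem_spanF_iff (J := J) (Pi.single 0 w)
  rw [Finset.sum_eq_single 0 (fun i _ hi => by simp [hi]) (by simp)] at this
  simp only [Fin.val_zero, pow_zero, one_smul, Pi.single_eq_same] at this
  rw [this]
  refine ⟨fun h => by simpa using h 0, fun h i => ?_⟩
  rcases eq_or_ne i 0 with rfl | hi
  · simpa
  · simp [hi]

/-- The coefficients of an element with respect to a Frobenius coordinate. -/
lemma exists_coef (w : W) : ∃ u : Fin q → W, w = ∑ i : Fin q, x ^ (i : ℕ) • F (u i) :=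
  (h.bij.2 w).imp fun _ h => h.symm

/-- The least submodule `J` such that `N` lies in the span of `F(J)`. -/
lemma exists_least (N : Submodule A W) :
    ∃ I : Submodule A W, ∀ J, I ≤ J ↔ N ≤ spanF F J := by
  choose c hc using h.exists_coef
  refine ⟨Submodule.span A {v | ∃ w ∈ N, ∃ i, c w i = v}, fun J => ?_⟩
  rw [Submodule.span_le]
  constructor
  · intro hJ w hw
    rw [hc w, h.mem_spanF_iff]
    exact fun i => hJ ⟨w, hw, i, rfl⟩
  · rintro hJ _ ⟨w, hw, i, rfl⟩
    have := hJ hw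
    rw [hc w, h.mem_spanF_iff] at this
    exact this i

end FrobCoord

/-! ### Base change of roots and minimal roots -/

section BaseChange

variable {B : Type*} [Ring B] {W' : Type*} [AddCommGroup W'] [Module B W'] {F' : W' →+ W'}
  {φ : A →+* B} (g : W →ₛₗ[φ] W') (hF : ∀ w, g (F w) = F' (g w))

lemma span_image_span (s : Set W) :
    Submodule.span B (g '' (Submodule.span A s)) = Submodule.span B (g '' s) := by
  refine le_antisymm (Submodule.span_le.2 ?_) (Submodule.span_mono
    (Set.image_mono Submodule.subset_span))
  have : Submodule.span A s ≤ (Submodule.span B (g '' s)).comap g :=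
    Submodule.span_le.2 fun w hw => Submodule.subset_span ⟨w, hw, rfl⟩
  rintro _ ⟨w, hw, rfl⟩
  exact this hw

include hF in
lemma span_image_spanF (N : Submodule A W) (hF' : ∃ q : ℕ, ∀ (a : B) (w : W'),
      F' (a • w) = a ^ q • F' w) :
    Submodule.span B (g '' spanF F N) = spanF F' (Submodule.span B (g '' N)) := by
  obtain ⟨q, hF'⟩ := hF'
  rw [spanF, span_image_span]
  refine le_antisymm (Submodule.span_le.2 ?_) (Submodule.span_le.2 ?_)
  · rintro _ ⟨_, ⟨w, hw, rfl⟩, rfl⟩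
    rw [hF]
    exact mem_spanF (Submodule.subset_span ⟨w, hw, rfl⟩)
  · rintro _ ⟨w, hw, rfl⟩
    induction hw using Submodule.span_induction with
    | mem w hw =>
      obtain ⟨w, hw, rfl⟩ := hw
      exact Submodule.subset_span ⟨F w, ⟨w, hw, rfl⟩, hF w⟩
    | zero => simp
    | add v w _ _ hv hw => rw [map_add]; exact Submodule.add_mem _ hv hw
    | smul a w _ hw => rw [hF']; exact Submodule.smul_mem _ _ hw

include hF in
lemma image_frobSpan_subset (S : Set W) {T : Set W'} (hT : g '' S ⊆ T) :
    g '' frobSpan (A := A) F S ⊆ frobSpan (A := B) F' T := by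
  have : frobSpan F S ≤ (frobSpan (A := B) F' T).comap g :=
    frobSpan_le (fun w hw => subset_frobSpan _ (hT ⟨w, hw, rfl⟩)) fun w hw => by
      rw [Submodule.mem_comap, hF]
      exact map_mem_frobSpan hw
  rintro _ ⟨w, hw, rfl⟩
  exact this hw

include hF in
lemma IsRoot.baseChange (hg : Submodule.span B (Set.range g) = ⊤)
    {N : Submodule A W} (hN : IsRoot F N) : IsRoot F' (Submodule.span B (g '' N)) where
  fg := by
    obtain ⟨s, hs⟩ := hN.fg
    classical
    refine ⟨s.image g, ?_⟩
    rw [← hs, span_image_span, Finset.coe_image]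
  le_span := by
    rw [Submodule.span_le]
    have : N ≤ (spanF F' (Submodule.span B (g '' N))).comap g :=
      hN.le_span.trans <| Submodule.span_le.2 <| by
        rintro _ ⟨w, hw, rfl⟩
        rw [SetLike.mem_coe, Submodule.mem_comap, hF]
        exact mem_spanF (Submodule.subset_span ⟨w, hw, rfl⟩)
    rintro _ ⟨w, hw, rfl⟩
    exact this hw
  frobSpan_eq_top := by
    rw [eq_top_iff, ← hg, Submodule.span_le]
    have := image_frobSpan_subset g hF (N : Set W) (T := Submodule.span B (g '' N))
      Submodule.subset_span
    rwa [hN.frobSpan_eq_top, Submodule.top_coe, Set.image_univ] at this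

include hF in
-- Since `g` carries the expansion of `w` in powers of `x` to that of `g w` in powers of `φ x`, the
-- hypothesis on `J` says that the coefficients of elements of `N` lie in `g⁻¹ J`. Minimality of `N`
-- is then applied to `g⁻¹ J`. Flatness plays no role.
lemma IsMinRoot.baseChange {q : ℕ} {x : A} (h : FrobCoord F q x) (h' : FrobCoord F' q (φ x))
    (hg : Submodule.span B (Set.range g) = ⊤)
    {N : Submodule A W} (hN : IsMinRoot F N) : IsMinRoot F' (Submodule.span B (g '' N)) := by
  refine ⟨hN.1.baseChange g hF hg, fun J hJ => ?_⟩
  have key : N ≤ J.comap g := hN.2 _ fun w hw => by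
    obtain ⟨u, rfl⟩ := h.exists_coef w
    have := hJ (Submodule.subset_span ⟨_, hw, rfl⟩)
    simp only [map_sum, map_smulₛₗ, hF, map_pow] at this
    rw [h'.mem_spanF_iff (fun i => g (u i))] at this
    exact (h.mem_spanF_iff u).2 this
  rw [Submodule.span_le]
  rintro _ ⟨w, hw, rfl⟩
  exact key hw

end BaseChange

end MinimalRoots

/-! ### Existence of roots and of minimal roots -/

section Existence

variable {A : Type*} [CommRing A] {W : Type*} [AddCommGroup W] [Module A W] {F : W →+ W}
  {q : ℕ} {x : A}

/-- The span `K n` of the `F^j v` with `j ≤ n` and `v` a generator exhausts `W`. The finitely many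
coefficients of each generator lie in some `K n`, so a large enough `K n` is contained in `spanF F
(K n)`. -/
lemma FrobCoord.exists_isRoot (h : FrobCoord F q x) (hF : IsFrobFG (A := A) F) :
    ∃ N : Submodule A W, IsRoot F N := by
  obtain ⟨s, hs⟩ := hF
  let K : ℕ → Submodule A W := fun n => Submodule.span A {w | ∃ j ≤ n, ∃ v ∈ s, F^[j] v = w}
  have hmono : Monotone K := fun m n hmn => Submodule.span_mono <| by
    rintro _ ⟨j, hj, v, hv, rfl⟩
    exact ⟨j, hj.trans hmn, v, hv, rfl⟩
  have hs0 : ∀ n, ∀ v ∈ s, v ∈ K n := fun n v hv =>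
    Submodule.subset_span ⟨0, n.zero_le, v, hv, rfl⟩
  have hsucc : ∀ n, ∀ w ∈ K n, F w ∈ K (n + 1) := fun n w hw => by
    induction hw using Submodule.span_induction with
    | mem w hw =>
      obtain ⟨j, hj, v, hv, rfl⟩ := hw
      exact Submodule.subset_span ⟨j + 1, by omega, v, hv, Function.iterate_succ_apply' _ _ _⟩
    | zero => simp
    | add v w _ _ hv hw => rw [map_add]; exact Submodule.add_mem _ hv hw
    | smul a w _ hw => rw [h.map_smul]; exact Submodule.smul_mem _ _ hw
  have hspan : ⨆ n, K n = ⊤ := by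
    rw [eq_top_iff, ← hs]
    refine frobSpan_le (fun v hv => Submodule.mem_iSup_of_mem 0 (hs0 0 v hv)) fun w hw => ?_
    obtain ⟨n, hn⟩ := (Submodule.mem_iSup_of_directed _ hmono.directed_le).1 hw
    exact Submodule.mem_iSup_of_mem (n + 1) (hsucc n w hn)
  have hex : ∀ v : W, ∃ n, v ∈ spanF F (K n) := fun v => by
    obtain ⟨u, rfl⟩ := h.exists_coef v
    have : ∀ i, ∃ n, u i ∈ K n := fun i =>
      (Submodule.mem_iSup_of_directed _ hmono.directed_le).1 (hspan ▸ Submodule.mem_top)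
    choose n hn using this
    refine ⟨Finset.univ.sup n, (h.mem_spanF_iff u).2 fun i => ?_⟩
    exact hmono (Finset.le_sup (Finset.mem_univ i)) (hn i)
  choose n hn using hex
  refine ⟨K (s.sup n), ?_, Submodule.span_le.2 ?_, ?_⟩
  · refine Submodule.fg_span (Set.Finite.subset
      ((Finset.range (s.sup n + 1) ×ˢ s).finite_toSet.image fun a : ℕ × W => F^[a.1] a.2) ?_)
    rintro _ ⟨j, hj, v, hv, rfl⟩
    exact ⟨(j, v), by simpa using ⟨by omega, hv⟩, rfl⟩
  · rintro _ ⟨j, hj, v, hv, rfl⟩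
    cases j with
    | zero => exact spanF_mono (hmono (Finset.le_sup hv)) (hn v)
    | succ j =>
      rw [Function.iterate_succ_apply']
      exact mem_spanF (Submodule.subset_span ⟨j, by omega, v, hv, rfl⟩)
  · rw [eq_top_iff, ← hs]
    exact frobSpan_mono fun v hv => hs0 _ v hv

/-- The chain lies between `tN` and `N`, so it is determined by its image in `N / tN`, a finite
module over the artinian ring `A / t`. -/
lemma exists_eq_succ_of_isArtinianRing_quotient (t : A) [IsArtinianRing (A ⧸ Ideal.span {t})]
    {N : Submodule A W} (hN : N.FG) (K : ℕ → Submodule A W) (hK : Antitone K) (h0 : K 0 = N)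
    (ht : ∀ n, ∀ w ∈ N, t • w ∈ K n) : ∃ n, K n = K (n + 1) := by
  have hle : ∀ n, K n ≤ N := fun n => h0 ▸ hK n.zero_le
  have : Module.Finite A N := Module.Finite.iff_fg.2 hN
  let I := Ideal.span {t}
  have : Module.Finite (A ⧸ I) (N ⧸ I • (⊤ : Submodule A N)) :=
    Module.Finite.of_restrictScalars_finite A _ _
  have : IsArtinian (A ⧸ I) (N ⧸ I • (⊤ : Submodule A N)) := inferInstance
  have : IsArtinian A (N ⧸ I • (⊤ : Submodule A N)) :=
    isArtinian_of_surjective_algebraMap (R := A ⧸ I) (S := A) Ideal.Quotient.mk_surjective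
  let L : ℕ →o (Submodule A (N ⧸ I • (⊤ : Submodule A N)))ᵒᵈ :=
    ⟨fun n => OrderDual.toDual (((K n).submoduleOf N).map (Submodule.mkQ _)),
      fun m n hmn => Submodule.map_mono (Submodule.comap_mono (hK hmn))⟩
  obtain ⟨n, hn⟩ := IsArtinian.monotone_stabilizes L
  refine ⟨n, le_antisymm (fun w hw => ?_) (hK n.le_succ)⟩
  have h1 : Submodule.mkQ (I • (⊤ : Submodule A N)) ⟨w, hle n hw⟩ ∈
      ((K (n + 1)).submoduleOf N).map (Submodule.mkQ _) := by
    have : ((K n).submoduleOf N).map (Submodule.mkQ (I • (⊤ : Submodule A N))) =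
      ((K (n + 1)).submoduleOf N).map (Submodule.mkQ _) := hn (n + 1) n.le_succ
    rw [← this]
    exact ⟨⟨w, hle n hw⟩, hw, rfl⟩
  obtain ⟨v, hv, he⟩ := h1
  rw [Submodule.mkQ_apply, Submodule.mkQ_apply, Submodule.Quotient.eq] at he
  have h2 : I • (⊤ : Submodule A N) ≤ (K (n + 1)).submoduleOf N := by
    rw [Submodule.ideal_span_singleton_smul]
    rintro _ ⟨u, -, rfl⟩
    exact ht (n + 1) u u.2
  have h3 := sub_mem hv (h2 he)
  rw [sub_sub_cancel] at h3
  exact h3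

/-- The operator `I`, sending `J` to the least submodule whose `spanF` contains `J`, shrinks roots
to roots. The multiplier `t` bounds its iterates from below, so they reach a fixed point; for a
fixed point, the universal property of `I` is the minimality condition. -/
theorem FrobCoord.exists_isMinRoot [IsNoetherianRing A] (h : FrobCoord F q x) (hq : 2 ≤ q)
    {N : Submodule A W} (hN : IsRoot F N) (t : A) [IsArtinianRing (A ⧸ Ideal.span {t})]
    (ht : ∀ w ∈ N, t • F w ∈ N) : ∃ N₀ : Submodule A W, IsMinRoot F N₀ := by
  choose I hI using h.exists_least
  have step : ∀ {J : Submodule A W}, IsRoot F J → I J ≤ J ∧ IsRoot F (I J) := fun {J} hJ => by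
    have h1 : I J ≤ J := (hI J J).2 hJ.le_span
    have h2 : J ≤ spanF F (I J) := (hI J _).1 le_rfl
    refine ⟨h1, ?_, h1.trans h2, ?_⟩
    · exact hJ.fg.of_le h1
    · rw [eq_top_iff, ← hJ.frobSpan_eq_top]
      exact frobSpan_le (h2.trans (spanF_le_frobSpan (subset_frobSpan _)))
        fun _ => map_mem_frobSpan
  have hroot : ∀ n, IsRoot F (I^[n] N) := fun n => by
    induction n with
    | zero => exact hN
    | succ n ih => rw [Function.iterate_succ_apply']; exact (step ih).2
  have hanti : Antitone fun n => I^[n] N := antitone_nat_of_succ_le fun n => by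
    rw [Function.iterate_succ_apply']; exact (step (hroot n)).1
  have hmem : ∀ n, ∀ w ∈ N, t • w ∈ I^[n] N := fun n => by
    induction n with
    | zero => exact fun w hw => N.smul_mem t hw
    | succ n ih =>
      intro w hw
      rw [Function.iterate_succ_apply', ← h.map_mem_spanF_iff (by omega), h.map_smul]
      refine (hI _ _).1 le_rfl ?_
      -- `F (t • w) = t ^ q • F w`. One factor `t` brings `F w` into `N`, a second brings the result
      -- into `I^[n] N` by induction; this is where `2 ≤ q` is needed.
      obtain ⟨m, rfl⟩ := Nat.exists_eq_add_of_le' hq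
      rw [pow_add, pow_two, mul_smul, mul_smul]
      exact Submodule.smul_mem _ _ (ih _ (ht w hw))
  obtain ⟨n, hn⟩ := exists_eq_succ_of_isArtinianRing_quotient t hN.fg _ hanti rfl hmem
  refine ⟨_, hroot n, fun J hJ => ?_⟩
  rw [hn, Function.iterate_succ_apply']
  exact (hI _ _).2 hJ

end Existence

/-! ## Frobenius and étale algebras -/

section RelativeFrobenius

open TensorProduct

/-- If the `x i` form a basis of `B` over `A`, then `B ⊗ W` is the direct sum of the copies `x i ⊗
W`. -/
lemma bijective_sum_smul_of_isBaseChange {A B W W' ι : Type*} [CommRing A] [CommRing B]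
    [Algebra A B] [AddCommGroup W] [Module A W] [AddCommGroup W'] [Module A W'] [Module B W']
    [IsScalarTower A B W'] [Fintype ι] {x : ι → B}
    (hx : Function.Bijective fun a : ι → A => ∑ i, x i * algebraMap A B (a i))
    {g : W →ₗ[A] W'} (hg : IsBaseChange B g) :
    Function.Bijective fun w : ι → W => ∑ i, x i • g (w i) := by
  classical
  have hx' : (fun a : ι → A => ∑ i, x i * algebraMap A B (a i)) =
      Fintype.linearCombination A x := by
    ext a
    simp [Fintype.linearCombination_apply, Algebra.smul_def, mul_comm]
  rw [hx'] at hx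
  let b : Module.Basis ι A B := Module.Basis.ofEquivFun (LinearEquiv.ofBijective _ hx).symm
  have hb : ∀ i, b i = x i := fun i => by
    simp [b, Fintype.linearCombination_apply, Module.Basis.coe_ofEquivFun]
  let e : (ι → W) ≃ₗ[A] W' := (Finsupp.linearEquivFunOnFinite A W ι).symm ≪≫ₗ
    (TensorProduct.equivFinsuppOfBasisLeft b).symm ≪≫ₗ hg.equiv.restrictScalars A
  have he : (fun w : ι → W => ∑ i, x i • g (w i)) = e := by
    ext w
    simp only [e, LinearEquiv.trans_apply, TensorProduct.equivFinsuppOfBasisLeft_symm_apply]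
    rw [Finsupp.sum_fintype _ _ (by simp), map_sum]
    refine Finset.sum_congr rfl fun i _ => ?_
    simp [hb, IsBaseChange.equiv_tmul]
  rw [he]
  exact e.bijective

/-- An étale map through which Frobenius factors on both sides is a universal homeomorphism, hence
an isomorphism. Concretely, the two inclusions of `B` in `B ⊗[C] B` agree modulo a nilpotent ideal,
so they are equal by unramifiedness, and faithfully flat descent then puts every `b` in the image of
`C`. -/
lemma bijective_algebraMap_of_frobenius_factor {p r : ℕ} [Fact p.Prime] {C B : Type u}
    [CommRing C] [CommRing B] [Algebra C B] (hC : (p : C) = 0) [Algebra.FormallyUnramified C B]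
    [Algebra.FiniteType C B] [Module.Flat C B] (σ : B →+* C)
    (h1 : ∀ c, σ (algebraMap C B c) = c ^ p ^ r) (h2 : ∀ b, algebraMap C B (σ b) = b ^ p ^ r) :
    Function.Bijective (algebraMap C B) := by
  have hq : p ^ r ≠ 0 := pow_ne_zero _ (Fact.out : p.Prime).ne_zero
  have hff : Module.FaithfullyFlat C B := by
    -- The composite of `algebraMap C B` and `σ` is a power of Frobenius, which induces the identity
    -- on the spectrum of `C`.
    refine .of_comap_surjective fun P => ⟨PrimeSpectrum.comap σ P, ?_⟩
    ext c
    simp [h1, P.isPrime.pow_mem_iff_mem _ (Nat.pos_of_ne_zero hq)]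
  refine ⟨FaithfulSMul.algebraMap_injective _ _, fun b => ?_⟩
  have hpB : ((p : ℕ) : B ⊗[C] B) = 0 := by
    rw [← map_natCast (algebraMap C (B ⊗[C] B)), hC, map_zero]
  -- Frobenius on `B ⊗[C] B` factors through multiplication, since `a ^ q` and `b ^ q` come from `C`
  -- and can cross the tensor sign. So the kernel of multiplication is nil, and nilpotent because it
  -- is finitely generated.
  have hfrob : frob p r _ hpB =
      (((Algebra.TensorProduct.includeLeft : B →ₐ[C] B ⊗[C] B).toRingHom.comp
        (algebraMap C B)).comp σ).comp (Algebra.TensorProduct.lmul' C (S := B)).toRingHom := by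
    refine RingHom.ext fun z => ?_
    induction z with
    | zero => simp
    | add z w hz hw => rw [map_add, map_add, hz, hw]
    | tmul a b =>
      have : (a ⊗ₜ[C] b : B ⊗[C] B) = (a ⊗ₜ 1) * (1 ⊗ₜ b) := by simp
      rw [this, map_mul, map_mul]
      congr 1
      · simp [frob, h2]
      · have : (1 : B) ⊗ₜ[C] (b ^ p ^ r) = algebraMap C B (σ b) ⊗ₜ[C] (1 : B) := by
          rw [← h2, Algebra.algebraMap_eq_smul_one, smul_tmul]
        simpa [frob] using this
  have hker : IsNilpotent (RingHom.ker
      ((Algebra.TensorProduct.lmul' C : B ⊗[C] B →ₐ[C] B) : B ⊗[C] B →+* B)) := by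
    refine (Ideal.FG.isNilpotent_iff_le_nilradical (KaehlerDifferential.ideal_fg C B)).2
      fun z hz => ⟨p ^ r, ?_⟩
    have := RingHom.congr_fun hfrob z
    rw [RingHom.comp_apply] at this
    refine this.trans ?_
    have hz' : (Algebra.TensorProduct.lmul' C (S := B)).toRingHom z = 0 := hz
    rw [hz', map_zero]
  have hext : (Algebra.TensorProduct.includeLeft : B →ₐ[C] B ⊗[C] B) =
      Algebra.TensorProduct.includeRight :=
    Algebra.FormallyUnramified.lift_unique' _ hker _ _ (by ext b; simp)
  have := Algebra.IsEffective.eqLocus_includeLeft_includeRight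
    (Algebra.IsEffective.of_faithfullyFlat C B)
  have hb : b ∈ Set.range (algebraMap C B) := by
    rw [← this]
    exact AlgHom.congr_fun hext b
  exact hb

/-- The relative Frobenius of an étale algebra is an isomorphism. Here `D'` and `B'` are the targets
of Frobenius on `D` and `B`, identified with them by `eD` and `eB`. The map `b ↦ 1 ⊗ eB b` serves as
`σ` in `bijective_algebraMap_of_frobenius_factor`. -/
lemma bijective_lift_of_frobenius {p r : ℕ} [Fact p.Prime] {D B D' B' : Type u} [CommRing D]
    [CommRing B] [CommRing D'] [CommRing B'] [Algebra D B] [Algebra D D'] [Algebra D' B']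
    [Algebra B B'] [Algebra D B'] [IsScalarTower D B B'] [IsScalarTower D D' B']
    [Algebra.Etale D B] [Algebra.Etale D' B'] (eD : D' ≃+* D) (eB : B' ≃+* B) (hD : (p : D') = 0)
    (h1 : ∀ b, eB (algebraMap B B' b) = b ^ p ^ r)
    (h2 : ∀ d, algebraMap D D' (eD d) = d ^ p ^ r)
    (h3 : ∀ d, eB (algebraMap D' B' d) = algebraMap D B (eD d)) :
    Function.Bijective (Algebra.TensorProduct.lift (Algebra.ofId D' B')
      (IsScalarTower.toAlgHom D B B') fun _ _ => Commute.all _ _) := by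
  let f : D' ⊗[D] B →ₐ[D'] B' := Algebra.TensorProduct.lift (Algebra.ofId D' B')
    (IsScalarTower.toAlgHom D B B') fun _ _ => Commute.all _ _
  let _ : Algebra (D' ⊗[D] B) B' := f.toRingHom.toAlgebra
  have : IsScalarTower D' (D' ⊗[D] B) B' := IsScalarTower.of_algebraMap_eq fun d =>
    (f.commutes d).symm
  have hC : ((p : ℕ) : D' ⊗[D] B) = 0 := by
    rw [← map_natCast (algebraMap D' (D' ⊗[D] B)), hD, map_zero]
  have : Algebra.Etale (D' ⊗[D] B) B' := Algebra.Etale.of_restrictScalars D' _ _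
  let σ : B' →+* D' ⊗[D] B :=
    (Algebra.TensorProduct.includeRight : B →ₐ[D] D' ⊗[D] B).toRingHom.comp eB.toRingHom
  have hf1 : ∀ d : D', f (d ⊗ₜ 1) = algebraMap D' B' d := fun d => f.commutes d
  have hf2 : ∀ b : B, f (1 ⊗ₜ b) = algebraMap B B' b := fun b => by
    simp only [f, Algebra.TensorProduct.lift_tmul, map_one, one_mul,
      IsScalarTower.coe_toAlgHom']
  have hσ : ∀ b : B', σ b = 1 ⊗ₜ eB b := fun b => rfl
  refine bijective_algebraMap_of_frobenius_factor (p := p) (r := r) hC σ (fun c => ?_)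
    fun b => ?_
  · have : σ.comp f.toRingHom = frob p r (D' ⊗[D] B) hC := by
      refine RingHom.ext fun z => ?_
      induction z using TensorProduct.induction_on with
      | zero => rw [map_zero, map_zero]
      | add z w hz hw => rw [map_add, map_add, hz, hw]
      | tmul a b =>
        have : (a ⊗ₜ[D] b : D' ⊗[D] B) = (a ⊗ₜ 1) * (1 ⊗ₜ b) := by simp
        rw [this, map_mul, map_mul]
        congr 1
        · have : σ (f (a ⊗ₜ 1)) = (a ^ p ^ r) ⊗ₜ 1 := by
            rw [hf1, hσ, h3, ← h2, Algebra.algebraMap_eq_smul_one, Algebra.algebraMap_eq_smul_one,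
              smul_tmul]
          refine Eq.trans this ?_
          change _ = (a ⊗ₜ[D] (1 : B)) ^ p ^ r
          rw [Algebra.TensorProduct.tmul_pow, one_pow]
        · have : σ (f (1 ⊗ₜ b)) = 1 ⊗ₜ (b ^ p ^ r) := by rw [hf2, hσ, h1]
          refine Eq.trans this ?_
          change _ = ((1 : D') ⊗ₜ[D] b) ^ p ^ r
          rw [Algebra.TensorProduct.tmul_pow, one_pow]
    exact RingHom.congr_fun this c
  · apply eB.injective
    change eB (f (σ b)) = _
    rw [hσ, hf2, h1, map_pow]

/-- A copy of a ring, regarded as the target of a power of Frobenius. -/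
def FrobTarget (A : Type*) : Type _ := A

instance (A : Type*) [CommRing A] : CommRing (FrobTarget A) := inferInstanceAs (CommRing A)

instance (D B : Type*) [CommRing D] [CommRing B] [Algebra D B] :
    Algebra (FrobTarget D) (FrobTarget B) := inferInstanceAs (Algebra D B)

lemma bijective_sum_pow_mul_pow_of_etale {p r : ℕ} [Fact p.Prime] {D B : Type u} [CommRing D]
    [CommRing B] [Algebra D B] [Algebra.Etale D B] (hD : (p : D) = 0) {ι : Type*} [Fintype ι]
    (x : ι → D) (hx : Function.Bijective fun a : ι → D => ∑ i, x i * a i ^ p ^ r) :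
    Function.Bijective fun b : ι → B => ∑ i, algebraMap D B (x i) * b i ^ p ^ r := by
  have hB : (p : B) = 0 := by rw [← map_natCast (algebraMap D B), hD, map_zero]
  let eD : FrobTarget D ≃+* D := RingEquiv.refl D
  let eB : FrobTarget B ≃+* B := RingEquiv.refl B
  let _ : Algebra D (FrobTarget D) := (eD.symm.toRingHom.comp (frob p r D hD)).toAlgebra
  let _ : Algebra B (FrobTarget B) := (eB.symm.toRingHom.comp (frob p r B hB)).toAlgebra
  let _ : Algebra D (FrobTarget B) :=
    ((algebraMap B (FrobTarget B)).comp (algebraMap D B)).toAlgebra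
  have : IsScalarTower D B (FrobTarget B) := IsScalarTower.of_algebraMap_eq' rfl
  have : IsScalarTower D (FrobTarget D) (FrobTarget B) := IsScalarTower.of_algebraMap_eq fun d =>
    (map_pow (algebraMap D B) d (p ^ r)).symm
  have : Algebra.Etale (FrobTarget D) (FrobTarget B) := inferInstanceAs (Algebra.Etale D B)
  have h1 := bijective_lift_of_frobenius (D := D) (B := B) (D' := FrobTarget D)
    (B' := FrobTarget B) (p := p) (r := r) eD eB hD (fun _ => rfl) (fun _ => rfl) fun _ => rfl
  have h2 : Function.Bijective fun b : ι → B =>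
      ∑ i, eD.symm (x i) • (TensorProduct.mk D (FrobTarget D) B 1) (b i) :=
    bijective_sum_smul_of_isBaseChange (x := fun i => eD.symm (x i)) hx
      (TensorProduct.isBaseChange D B (FrobTarget D))
  have h3 := eB.bijective.comp (h1.comp h2)
  convert h3 using 1
  ext b
  rw [Function.comp_apply, Function.comp_apply, map_sum, map_sum]
  refine Finset.sum_congr rfl fun i _ => ?_
  rw [TensorProduct.mk_apply, TensorProduct.smul_tmul', smul_eq_mul, mul_one,
    Algebra.TensorProduct.lift_tmul, map_mul]
  rfl

/-- For an étale algebra `B` over a ring `D` in which the powers of `x` form a basis over `q`-th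
powers, unit Frobenius modules over `B` have `x` as a Frobenius coordinate. -/
lemma FrobCoord.of_isBaseChangeAlong {p r : ℕ} [Fact p.Prime] {B W : Type u} [CommRing B]
    [AddCommGroup W] [Module B W] (hB : (p : B) = 0) {x : B}
    (hx : Function.Bijective
      fun a : Fin (p ^ r) → B => ∑ i : Fin (p ^ r), x ^ (i : ℕ) * a i ^ p ^ r)
    {F : W →+ W} (hF : ∀ (s : B) (w : W), F (s • w) = frob p r B hB s • F w)
    (h : IsBaseChangeAlong (frob p r B hB) F hF) : FrobCoord F (p ^ r) x where
  map_smul := hF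
  span a := by
    obtain ⟨b, hb⟩ := hx.2 a
    exact ⟨b, hb.symm⟩
  bij := by
    -- Source and target of Frobenius get different names, so that its algebra structure does not
    -- clash with the action of `B` on itself.
    have key : ∀ {A B W W' : Type u} [CommRing A] [CommRing B] (φ : A →+* B) [AddCommGroup W]
        [Module A W] [AddCommGroup W'] [Module B W'] (g : W →+ W')
        (hg : ∀ (a : A) (w : W), g (a • w) = φ a • g w) (_ : IsBaseChangeAlong φ g hg)
        (x : Fin (p ^ r) → B)
        (_ : Function.Bijective fun a : Fin (p ^ r) → A => ∑ i, x i * φ (a i)),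
        Function.Bijective fun w : Fin (p ^ r) → W => ∑ i, x i • g (w i) := by
      intro A B W W' _ _ φ _ _ _ _ g hg h x hx
      let _ : Algebra A B := φ.toAlgebra
      let _ : Module A W' := Module.compHom W' φ
      have : IsScalarTower A B W' := ⟨fun a b w => mul_smul (φ a) b w⟩
      exact bijective_sum_smul_of_isBaseChange hx h
    exact key _ F hF h _ hx

end RelativeFrobenius

/-! ## Existence of minimal roots over étale algebras over the affine line -/

section Polynomial

open Polynomial

/-- The coefficient of `X ^ (m * q + i)` in the sum is the `q`-th power of the `m`-th coefficient of
`a i`. Division with remainder by `q` separates the `a i`, and the `q`-th power map is bijective on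
a perfect field. -/
lemma bijective_sum_X_pow_mul_pow (K : Type*) [Field K] {p r : ℕ} [Fact p.Prime] [CharP K p]
    [PerfectField K] :
    Function.Bijective fun a : Fin (p ^ r) → K[X] =>
      ∑ i : Fin (p ^ r), (X : K[X]) ^ (i : ℕ) * a i ^ p ^ r := by
  have hq : 0 < p ^ r := Nat.pos_of_ne_zero (pow_ne_zero _ (Fact.out : p.Prime).ne_zero)
  have : NeZero (p ^ r) := ⟨hq.ne'⟩
  have : ExpChar K p := ExpChar.prime Fact.out
  have : PerfectRing K p := PerfectField.toPerfectRing p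
  have hcoeff : ∀ (a : K[X]) (m : ℕ), (a ^ p ^ r).coeff (m * p ^ r) = a.coeff m ^ p ^ r := by
    intro a m
    rw [← map_iterateFrobenius_expand, coeff_map, coeff_expand_mul hq, iterateFrobenius_def]
  have hcoeff' : ∀ (a : K[X]) (n : ℕ), ¬ p ^ r ∣ n → (a ^ p ^ r).coeff n = 0 := by
    intro a n hn
    rw [← map_iterateFrobenius_expand, coeff_map, coeff_expand hq, if_neg hn, map_zero]
  have hsum : ∀ (a : Fin (p ^ r) → K[X]) (i : Fin (p ^ r)) (m : ℕ),
      (∑ i : Fin (p ^ r), (X : K[X]) ^ (i : ℕ) * a i ^ p ^ r).coeff (m * p ^ r + i) =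
        (a i).coeff m ^ p ^ r := by
    intro a i m
    rw [finsetSum_coeff, Finset.sum_eq_single i]
    · rw [coeff_X_pow_mul, hcoeff]
    · intro j _ hj
      rw [coeff_X_pow_mul']
      split_ifs with h
      · refine hcoeff' _ _ fun hd => hj (Fin.ext ?_)
        have h1 : (m * p ^ r + i) ≡ j [MOD p ^ r] := ((Nat.modEq_iff_dvd' h).2 hd).symm
        have h2 : m * p ^ r + i ≡ i [MOD p ^ r] := by simp [Nat.ModEq]
        exact (h1.symm.trans h2).eq_of_lt_of_lt j.2 i.2
      · rfl
    · simp
  have hinj : Function.Injective fun c : K => c ^ p ^ r := by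
    intro c d hcd
    exact iterateFrobenius_inj K p r hcd
  constructor
  · intro a b hab
    funext i
    ext m
    have := congr_arg (fun f : K[X] => f.coeff (m * p ^ r + i)) hab
    simp only [hsum] at this
    exact hinj this
  · intro f
    choose c hc using fun x : K => (bijective_iterateFrobenius K p r).2 x
    simp only [iterateFrobenius_def] at hc
    have h0 : c 0 = 0 := pow_eq_zero_iff hq.ne' |>.1 (hc 0)
    refine ⟨fun i => ∑ m ∈ Finset.range (f.natDegree + 1), monomial m (c (f.coeff (m * p ^ r + i))),
      ?_⟩
    ext n
    have hn : n = (n / p ^ r) * p ^ r + (Fin.ofNat (p ^ r) n : Fin (p ^ r)) := by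
      simp [Nat.div_add_mod']
    rw [hn, hsum, finsetSum_coeff]
    simp only [coeff_monomial, Finset.sum_ite_eq', Finset.mem_range]
    split_ifs with h
    · rw [hc]
    · rw [zero_pow hq.ne', coeff_eq_zero_of_natDegree_lt]
      refine lt_of_lt_of_le (by omega) (le_trans (Nat.le_mul_of_pos_right _ hq)
        (Nat.le_add_right _ _))

end Polynomial

/-! ### Ranks over a domain and denominators of Frobenius -/

section Rank

variable {D : Type u} [CommRing D] [IsDomain D]

lemma rank_quotient_eq_zero_iff {V : Type u} [AddCommGroup V] [Module D V] (P : Submodule D V) :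
    Module.rank D (V ⧸ P) = 0 ↔ ∀ v : V, ∃ a : D, a ≠ 0 ∧ a • v ∈ P := by
  rw [Module.rank_eq_zero_iff_isTorsion]
  constructor
  · intro h v
    obtain ⟨⟨a, ha⟩, h⟩ := @h (P.mkQ v)
    refine ⟨a, nonZeroDivisors.ne_zero ha, ?_⟩
    rwa [← Submodule.Quotient.mk_eq_zero, Submodule.Quotient.mk_smul]
  · intro h v
    obtain ⟨v, rfl⟩ := P.mkQ_surjective v
    obtain ⟨a, ha, h⟩ := h v
    refine ⟨⟨a, mem_nonZeroDivisors_of_ne_zero ha⟩, ?_⟩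
    rwa [← Submodule.Quotient.mk_eq_zero, Submodule.Quotient.mk_smul] at h

/-- The elements of `V` which have a nonzero multiple in `P`. -/
def torsionClosure {V : Type u} [AddCommGroup V] [Module D V] (P : Submodule D V) :
    Submodule D V where
  carrier := {v | ∃ a : D, a ≠ 0 ∧ a • v ∈ P}
  zero_mem' := ⟨1, one_ne_zero, by simp⟩
  add_mem' := by
    rintro v w ⟨a, ha, hv⟩ ⟨b, hb, hw⟩
    refine ⟨a * b, mul_ne_zero ha hb, ?_⟩
    rw [smul_add, mul_smul a b w, mul_comm, mul_smul]
    exact add_mem (P.smul_mem _ hv) (P.smul_mem _ hw)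
  smul_mem' := by
    rintro d v ⟨a, ha, hv⟩
    exact ⟨a, ha, by rw [smul_comm]; exact P.smul_mem _ hv⟩

lemma rank_le_of_torsion {V : Type u} [AddCommGroup V] [Module D V] {ι : Type u}
    (e : ι → V) (h : ∀ v : V, ∃ a : D, a ≠ 0 ∧ a • v ∈ Submodule.span D (Set.range e)) :
    Module.rank D V ≤ Cardinal.mk ι := by
  rw [← Submodule.rank_quotient_add_rank (Submodule.span D (Set.range e)),
    (rank_quotient_eq_zero_iff _).2 h, zero_add]
  exact (rank_span_le _).trans Cardinal.mk_range_le

/-- By additivity of the rank, where finiteness permits cancellation, the quotient has rank zero and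
is therefore torsion. -/
lemma exists_torsion_of_rank {V : Type u} [AddCommGroup V] [Module D V] {P : Submodule D V}
    (hr : Module.rank D V ≤ Module.rank D P) (hfin : Module.rank D P < Cardinal.aleph0) (v : V) :
    ∃ a : D, a ≠ 0 ∧ a • v ∈ P := by
  have h := Submodule.rank_quotient_add_rank P
  have h1 : Module.rank D (V ⧸ P) + Module.rank D P ≤ 0 + Module.rank D P := by
    rw [h, zero_add]; exact hr
  exact (rank_quotient_eq_zero_iff P).1
    (le_antisymm ((Cardinal.add_le_add_iff_of_lt_aleph0 hfin).1 h1) zero_le) v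

variable (D) in
lemma exists_maximal_family (V : Type u) [AddCommGroup V] [Module D V]
    (hfin : Module.rank D V < Cardinal.aleph0) :
    ∃ s : Set V, Cardinal.mk s = Module.rank D V ∧
      ∀ v : V, ∃ a : D, a ≠ 0 ∧ a • v ∈ Submodule.span D s := by
  obtain ⟨s, hs, hli⟩ := exists_set_linearIndependent D V
  have : Module.rank D (Submodule.span D s) = Module.rank D V := by
    have := rank_span hli
    rw [Subtype.range_coe] at this
    rw [this, hs]
  exact ⟨s, hs, exists_torsion_of_rank this.ge (this ▸ hfin)⟩

variable {A : Type u} [CommRing A] [Algebra D A]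

variable (D) in
-- The rank is unchanged by passing to the fraction field, where quasi-finite means
-- finite-dimensional.
lemma rank_lt_aleph0_of_quasiFinite [Algebra.QuasiFinite D A] :
    Module.rank D A < Cardinal.aleph0 := by
  let K := FractionRing D
  have : Module.Finite K (TensorProduct D K A) := Module.Finite.of_quasiFinite
  have h1 := IsLocalizedModule.lift_rank_eq (nonZeroDivisors D) (TensorProduct.mk D K A 1) le_rfl
  rw [Cardinal.lift_id, Cardinal.lift_id] at h1
  rw [← h1, ← IsLocalization.rank_eq K (nonZeroDivisors D) le_rfl]
  exact Module.rank_lt_aleph0 K _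

lemma rank_lt_aleph0_of_finite [Algebra.QuasiFinite D A] (V : Type u) [AddCommGroup V]
    [Module A V] [Module D V] [IsScalarTower D A V] [Module.Finite A V] :
    Module.rank D V < Cardinal.aleph0 := by
  obtain ⟨s, hs, hst⟩ := exists_maximal_family D A (rank_lt_aleph0_of_quasiFinite D)
  have hsfin : Finite s := Cardinal.lt_aleph0_iff_finite.1 (hs ▸ rank_lt_aleph0_of_quasiFinite D)
  obtain ⟨T, hT⟩ := Module.Finite.fg_top (R := A) (M := V)
  refine lt_of_le_of_lt (rank_le_of_torsion (D := D)
    (fun z : s × T => (z.1 : A) • (z.2 : V)) fun v => ?_) Cardinal.mk_lt_aleph0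
  obtain ⟨c, -, rfl⟩ := Submodule.mem_span_finset.1 (hT ▸ Submodule.mem_top : v ∈ Submodule.span A T)
  change _ ∈ torsionClosure _
  refine sum_mem fun t ht => ?_
  · obtain ⟨a, ha, h⟩ := hst (c t)
    refine ⟨a, ha, ?_⟩
    rw [← smul_assoc]
    generalize a • c t = y at h
    induction h using Submodule.span_induction with
    | mem y hy => exact Submodule.subset_span ⟨(⟨y, hy⟩, ⟨t, ht⟩), rfl⟩
    | zero => simp
    | add y z _ _ hy hz => rw [add_smul]; exact add_mem hy hz
    | smul d y _ hy => rw [smul_assoc]; exact Submodule.smul_mem _ _ hy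

/-- Over an étale algebra over a domain of dimension one, the span of `F(N)` is contained in `N` up
to a nonzero factor. -/
lemma FrobCoord.exists_smul_mem [Algebra.QuasiFinite D A] {W : Type u}
    [AddCommGroup W] [Module A W] {F : W →+ W} {q : ℕ} {x : D}
    (h : FrobCoord F q (algebraMap D A x)) {N : Submodule A W}
    (hN : N.FG) (hroot : N ≤ spanF F N) :
    ∃ t : D, t ≠ 0 ∧ ∀ w ∈ spanF F N, algebraMap D A t • w ∈ N := by
  let _ : Module D W := Module.compHom W (algebraMap D A)
  have : IsScalarTower D A W := IsScalarTower.of_algebraMap_smul fun _ _ => rfl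
  have : Module.Finite A N := Module.Finite.iff_fg.2 hN
  have hsmul : ∀ (d : D) (w : W), F (d • w) = d ^ q • F w := fun d w => by
    rw [← algebraMap_smul A d w, h.map_smul, ← map_pow, algebraMap_smul]
  have hfinN := rank_lt_aleph0_of_finite (D := D) (A := A) N
  obtain ⟨s, hs, hst⟩ := exists_maximal_family D N hfinN
  have hFG : (spanF F N).FG := by
    obtain ⟨T, hT⟩ := hN
    classical
    refine ⟨T.image F, ?_⟩
    refine le_antisymm (Submodule.span_mono ?_) (Submodule.span_le.2 ?_)
    · rw [Finset.coe_image]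
      exact Set.image_mono (hT ▸ Submodule.subset_span)
    · rintro _ ⟨w, hw, rfl⟩
      rw [SetLike.mem_coe, ← hT] at hw
      induction hw using Submodule.span_induction with
      | mem w hw => exact Submodule.subset_span (by simpa using ⟨w, hw, rfl⟩)
      | zero => simp
      | add y z _ _ hy hz => rw [map_add]; exact add_mem hy hz
      | smul d y _ hy => rw [h.map_smul]; exact Submodule.smul_mem _ _ hy
  let P : Submodule D (spanF F N) := (N.submoduleOf (spanF F N)).restrictScalars D
  let eP : P ≃ₗ[D] N := (Submodule.submoduleOfEquivOfLe hroot).restrictScalars D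
  have hP : Module.rank D P = Module.rank D N := eP.rank_eq
  -- The rank does not grow under `spanF`. If `s` spans `N` up to torsion, then `F(s)` spans `spanF
  -- F N` over `D` up to torsion: `a • u` in the span of `s` gives `a ^ q • F u` in that of `F(s)`,
  -- and the remaining factors `x ^ i` already lie in `D`.
  have hle : Module.rank D (spanF F N) ≤ Module.rank D P := by
    rw [hP, ← hs]
    refine rank_le_of_torsion (D := D)
      (fun v : s => (⟨F (v : N), mem_spanF (v : N).2⟩ : spanF F N)) fun v => ?_
    obtain ⟨v, hv⟩ := v
    obtain ⟨u, hu, rfl⟩ := h.exists_of_mem_spanF hv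
    have heq : (⟨∑ i : Fin q, algebraMap D A x ^ (i : ℕ) • F (u i), hv⟩ : spanF F N) =
        ∑ i : Fin q, x ^ (i : ℕ) • (⟨F (u i), mem_spanF (hu i)⟩ : spanF F N) := by
      refine Subtype.ext ?_
      rw [AddSubmonoidClass.coe_finsetSum]
      change ∑ i : Fin q, algebraMap D A x ^ (i : ℕ) • F (u i) = _
      refine Finset.sum_congr rfl fun i _ => ?_
      rw [← map_pow, algebraMap_smul]
      rfl
    rw [heq]
    change _ ∈ torsionClosure _
    refine sum_mem fun i _ => Submodule.smul_mem _ _ ?_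
    obtain ⟨a, ha, hau⟩ := hst ⟨u i, hu i⟩
    refine ⟨a ^ q, pow_ne_zero _ ha, ?_⟩
    have key : ∀ y ∈ Submodule.span D s, (⟨F (y : N), mem_spanF (y : N).2⟩ : spanF F N) ∈
        Submodule.span D (Set.range
          (fun v : s => (⟨F (v : N), mem_spanF (v : N).2⟩ : spanF F N))) := by
      intro y hy
      induction hy using Submodule.span_induction with
      | mem y hy => exact Submodule.subset_span ⟨⟨y, hy⟩, rfl⟩
      | zero => convert Submodule.zero_mem _; simp
      | add y z _ _ hy hz =>
        convert add_mem hy hz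
        simp
      | smul d y _ hy =>
        convert Submodule.smul_mem _ (d ^ q) hy
        exact hsmul d _
    convert key _ hau
    exact (hsmul a _).symm
  have htors := exists_torsion_of_rank hle (hP ▸ hfinN)
  obtain ⟨T, hT⟩ := hFG
  have hTmem : ∀ w ∈ T, w ∈ spanF F N := fun w hw => hT ▸ Submodule.subset_span hw
  choose! a ha haw using fun w (hw : w ∈ T) => htors ⟨w, hTmem w hw⟩
  -- The product of the denominators of finitely many `A`-generators is a common denominator.
  refine ⟨∏ w ∈ T, a w, Finset.prod_ne_zero_iff.2 ha, ?_⟩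
  suffices spanF F N ≤ N.comap (LinearMap.lsmul A W (algebraMap D A (∏ w ∈ T, a w))) from this
  rw [← hT, Submodule.span_le]
  intro w hw
  classical
  rw [SetLike.mem_coe, Submodule.mem_comap, LinearMap.lsmul_apply, ← Finset.mul_prod_erase T a hw,
    mul_comm, map_mul, mul_smul]
  exact N.smul_mem _ (haw w hw)

end Rank

lemma isArtinianRing_tensorProduct (D D₀ A : Type*) [CommRing D] [CommRing D₀] [CommRing A]
    [Algebra D D₀] [Algebra D A] [IsArtinianRing D₀] [Algebra.QuasiFinite D A] :
    IsArtinianRing (TensorProduct D D₀ A) :=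
  have : Module.Finite D₀ (TensorProduct D D₀ A) := Module.Finite.of_quasiFinite
  IsArtinianRing.of_finite D₀ _

open Polynomial in
/-- A finitely generated unit Frobenius module over an étale algebra over the affine line has a
minimal root. -/
theorem FrobCoord.exists_isMinRoot_of_etale {K A W : Type u} [Field K] [CommRing A]
    [Algebra K[X] A] [Algebra.Etale K[X] A] [AddCommGroup W] [Module A W] {F : W →+ W} {q : ℕ}
    (hq : 2 ≤ q) (h : FrobCoord F q (algebraMap K[X] A X)) (hF : IsFrobFG (A := A) F) :
    ∃ N : Submodule A W, IsMinRoot F N := by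
  have : IsNoetherianRing A := Algebra.FiniteType.isNoetherianRing K[X] A
  obtain ⟨N, hN⟩ := h.exists_isRoot hF
  obtain ⟨t, ht, htN⟩ := h.exists_smul_mem hN.fg hN.le_span
  have h1 : IsArtinianRing (K[X] ⧸ Ideal.span {t}) := by
    have := ((isFiniteLength_iff_isNoetherian_isArtinian).1
      (isFiniteLength_quotient_span_singleton K[X] (mem_nonZeroDivisors_of_ne_zero ht))).2
    exact isArtinian_of_tower K[X] this
  -- `A / tA` is the base change of the quasi-finite algebra `A` to the artinian ring `K[X] / t`,
  -- hence artinian.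
  let I := Ideal.span {t}
  have h3 := isArtinianRing_tensorProduct K[X] (K[X] ⧸ I) A
  have h4 : IsArtinianRing (A ⧸ I.map (algebraMap K[X] A)) := by
    let e := Algebra.TensorProduct.quotIdealMapEquivTensorQuot A I
    let e' := Algebra.TensorProduct.comm K[X] A (K[X] ⧸ I)
    exact ((e.toRingEquiv.trans e'.toRingEquiv).symm.surjective).isArtinianRing
  rw [Ideal.map_span, Set.image_singleton] at h4
  exact h.exists_isMinRoot hq hN (algebraMap K[X] A t) fun w hw => htN _ (mem_spanF hw)

/-! ## Flat descent for membership in a submodule -/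

section Descent

open TensorProduct

/-- The ideal of all `a` with `a • m ∈ N` is the kernel of `A → W / N`, `1 ↦ m`. Forming this kernel
commutes with flat base change, and over `B` the map sends `1` to zero. -/
lemma map_ker_toSpanSingleton_eq_top {A B W W' : Type*} [CommRing A] [CommRing B] [Algebra A B]
    [Module.Flat A B] [AddCommGroup W] [Module A W] [AddCommGroup W'] [Module A W'] [Module B W']
    [IsScalarTower A B W'] {g : W →ₗ[A] W'} (hg : IsBaseChange B g) (N : Submodule A W) (m : W)
    (hm : g m ∈ Submodule.span B (g '' N)) :
    Ideal.map (algebraMap A B) (LinearMap.ker (LinearMap.toSpanSingleton A (W ⧸ N) (N.mkQ m))) =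
      ⊤ := by
  set s := LinearMap.toSpanSingleton A (W ⧸ N) (N.mkQ m)
  let q : W' →ₗ[B] B ⊗[A] (W ⧸ N) :=
    (AlgebraTensorModule.lTensor B B N.mkQ).comp hg.equiv.symm.toLinearMap
  have hq : ∀ w, q (g w) = 1 ⊗ₜ N.mkQ w := fun w => by
    simp only [q, LinearMap.comp_apply, LinearEquiv.coe_coe, IsBaseChange.equiv_symm_apply]
    simp
  have hqm : q (g m) = 0 := by
    have : Submodule.span B (g '' N) ≤ LinearMap.ker q := Submodule.span_le.2 <| by
      rintro _ ⟨n, hn, rfl⟩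
      rw [SetLike.mem_coe, LinearMap.mem_ker, hq, N.mkQ_apply,
        (Submodule.Quotient.mk_eq_zero N).2 hn, tmul_zero]
    exact this hm
  have hs : s.lTensor B ((1 : B) ⊗ₜ (1 : A)) = 0 := by
    rw [LinearMap.lTensor_tmul, LinearMap.toSpanSingleton_apply_one, ← hq, hqm]
  have hex : Function.Exact ((LinearMap.ker s).subtype.lTensor B) (s.lTensor B) :=
    Module.Flat.lTensor_exact B (LinearMap.exact_subtype_ker_map s)
  obtain ⟨z, hz⟩ := (hex _).1 hs
  rw [Ideal.eq_top_iff_one]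
  have hrid : ∀ z : B ⊗[A] LinearMap.ker s,
      AlgebraTensorModule.rid A B B ((LinearMap.ker s).subtype.lTensor B z) ∈
        Ideal.map (algebraMap A B) (LinearMap.ker s) := fun z => by
    induction z with
    | zero => simp
    | add y z hy hz => rw [map_add, map_add]; exact add_mem hy hz
    | tmul b a =>
      rw [LinearMap.lTensor_tmul, AlgebraTensorModule.rid_tmul, Algebra.smul_def]
      exact Ideal.mul_mem_right _ _ (Ideal.mem_map_of_mem _ a.2)
  have := hrid z
  rwa [hz, AlgebraTensorModule.rid_tmul, one_smul] at this

/-- Flatness makes `B ⊗ N → B ⊗ W ≃ W'` injective, and its image is the span of `g(N)`. -/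
lemma isBaseChange_restrict {A B W W' : Type*} [CommRing A] [CommRing B] [Algebra A B]
    [Module.Flat A B] [AddCommGroup W] [Module A W] [AddCommGroup W'] [Module A W'] [Module B W']
    [IsScalarTower A B W'] {g : W →ₗ[A] W'} (hg : IsBaseChange B g) (N : Submodule A W)
    (N' : Submodule B W') (hN : Submodule.span B (g '' N) = N')
    (g' : N →ₗ[A] N') (hgg : ∀ w, (g' w : W') = g w) :
    IsBaseChange B g' := by
  let f : B ⊗[A] N →ₗ[B] W' :=
    hg.equiv.toLinearMap.comp (AlgebraTensorModule.lTensor B B N.subtype)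
  have hf : ∀ (b : B) (n : N), f (b ⊗ₜ n) = b • g n := fun b n => by
    simp [f, IsBaseChange.equiv_tmul]
  have hinj : Function.Injective f :=
    hg.equiv.injective.comp (Module.Flat.lTensor_preserves_injective_linearMap (M := B)
      N.subtype N.injective_subtype)
  have hrange : LinearMap.range f = N' := by
    rw [← hN]
    refine le_antisymm ?_ (Submodule.span_le.2 ?_)
    · rintro _ ⟨z, rfl⟩
      induction z with
      | zero => simp
      | add y z hy hz => rw [map_add]; exact add_mem hy hz
      | tmul b n =>
        rw [hf]
        exact Submodule.smul_mem _ _ (Submodule.subset_span ⟨n, n.2, rfl⟩)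
    · rintro _ ⟨n, hn, rfl⟩
      exact ⟨1 ⊗ₜ ⟨n, hn⟩, by rw [hf, one_smul]⟩
  let e : B ⊗[A] N ≃ₗ[B] N' :=
    (LinearEquiv.ofInjective f hinj).trans (LinearEquiv.ofEq _ _ hrange)
  refine IsBaseChange.of_equiv e fun n => Subtype.ext ?_
  rw [hgg]
  change f (1 ⊗ₜ n) = _
  rw [hf, one_smul]

namespace IsBaseChangeAlong

variable {A B : Type*} [CommRing A] [CommRing B] {φ : A →+* B} {W W' : Type*} [AddCommGroup W]
  [Module A W] [AddCommGroup W'] [Module B W'] {g : W →+ W'}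
  {hg : ∀ (a : A) (w : W), g (a • w) = φ a • g w}

lemma span_range (h : IsBaseChangeAlong φ g hg) : Submodule.span B (Set.range g) = ⊤ := by
  let _ : Algebra A B := φ.toAlgebra
  let _ : Module A W' := Module.compHom W' φ
  have : IsScalarTower A B W' := ⟨fun a b w => mul_smul (φ a) b w⟩
  rw [eq_top_iff]
  intro w _
  induction w using IsBaseChange.inductionOn h with
  | zero => exact zero_mem _
  | tmul w => exact Submodule.subset_span ⟨w, rfl⟩
  | smul b w hw => exact Submodule.smul_mem _ _ (hw trivial)
  | add y z hy hz => exact add_mem (hy trivial) (hz trivial)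

/-- The annihilator of the class of `m` modulo `N` generates the unit ideal in flat algebras over
which `m` lies in the submodule generated by `N`. -/
lemma map_eq_top (h : IsBaseChangeAlong φ g hg) (hφ : φ.Flat) (N : Submodule A W) (m : W)
    (hm : g m ∈ Submodule.span B (g '' N)) :
    Ideal.map φ (LinearMap.ker (LinearMap.toSpanSingleton A (W ⧸ N) (N.mkQ m))) = ⊤ := by
  let _ : Algebra A B := φ.toAlgebra
  let _ : Module A W' := Module.compHom W' φ
  have : IsScalarTower A B W' := ⟨fun a b w => mul_smul (φ a) b w⟩
  have : Module.Flat A B := hφ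
  exact map_ker_toSpanSingleton_eq_top h N m hm

/-- The restriction of a base change along a flat map to a submodule. -/
lemma restrict (h : IsBaseChangeAlong φ g hg) (hφ : φ.Flat) (N : Submodule A W)
    (N' : Submodule B W') (hN : Submodule.span B (g '' N) = N') (g' : N →+ N')
    (hg' : ∀ (a : A) (w : N), g' (a • w) = φ a • g' w) (hgg : ∀ w, (g' w : W') = g w) :
    IsBaseChangeAlong φ g' hg' := by
  let _ : Algebra A B := φ.toAlgebra
  let _ : Module A W' := Module.compHom W' φ
  have : IsScalarTower A B W' := ⟨fun a b w => mul_smul (φ a) b w⟩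
  have : Module.Flat A B := hφ
  exact isBaseChange_restrict h N N' hN { g' with map_smul' := hg' } hgg

end IsBaseChangeAlong

end Descent

/-! ## Affine objects of the small étale site -/

section Site

variable {X : Scheme.{u}}

lemma mem_smallGrothendieckTopology_iff (P : MorphismProperty Scheme.{u}) [P.IsMultiplicative]
    [P.IsStableUnderBaseChange] [P.HasOfPostcompProperty P] {U : P.Over ⊤ X}
    (S : Sieve U) :
    S ∈ X.smallGrothendieckTopology (P := P) (Q := P) U ↔
      ∀ x : U.left, ∃ (Y : P.Over ⊤ X) (g : Y ⟶ U) (y : Y.left), S g ∧ g.left y = x := by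
  rw [Scheme.smallGrothendieckTopology_eq_toGrothendieck_smallPretopology X le_rfl,
    Scheme.mem_toGrothendieck_smallPretopology]
  refine forall_congr' fun x => exists_congr fun Y => exists_congr fun g => exists_congr fun y => ?_
  refine ⟨fun h => ⟨h.1, h.2.2⟩, fun h => ⟨h.1, ?_, h.2⟩⟩
  refine P.of_postcomp (W' := P) g.left U.hom U.prop ?_
  rw [show g.left ≫ U.hom = Y.hom from Over.w g.hom]
  exact Y.prop

lemma mem_smallEtaleTopology_iff {U : X.Etale} (S : Sieve U) :
    S ∈ X.smallEtaleTopology U ↔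
      ∀ x : U.left, ∃ (Y : X.Etale) (g : Y ⟶ U) (y : Y.left), S g ∧ g.left y = x :=
  mem_smallGrothendieckTopology_iff @Etale S

lemma exists_fac_ι {Y Z : Scheme.{u}} (f : Y ⟶ Z) (W : Z.Opens) (h : ∀ y : Y, f y ∈ W) :
    ∃ f' : Y ⟶ W, f' ≫ W.ι = f := by
  have hr : Set.range f ⊆ Set.range W.ι := by
    rintro _ ⟨y, rfl⟩
    rw [Scheme.Opens.range_ι]
    exact h y
  exact ⟨IsOpenImmersion.lift W.ι f hr, IsOpenImmersion.lift_fac W.ι f hr⟩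

lemma etale_appTop {Y Z : Scheme.{u}} [IsAffine Y] [IsAffine Z] (f : Y ⟶ Z) [Etale f] :
    f.appTop.hom.Etale :=
  (HasRingHomProperty.iff_of_isAffine (P := @Etale)).1 inferInstance

lemma flat_appTop {Y Z : Scheme.{u}} [IsAffine Y] [IsAffine Z] (f : Y ⟶ Z) [Etale f] :
    f.appTop.hom.Flat :=
  (HasRingHomProperty.iff_of_isAffine (P := @Flat)).1 inferInstance

lemma comap_isoSpec_hom {Y Z : Scheme.{u}} [IsAffine Y] [IsAffine Z] (f : Y ⟶ Z) (y : Y) :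
    PrimeSpectrum.comap f.appTop.hom (Y.isoSpec.hom y) = Z.isoSpec.hom (f y) := by
  exact congr($(Scheme.toSpecΓ_naturality f) y).symm

/-- The point `z` is a maximal ideal containing `I`. The extension of `I` to any `Y` with a point
`y` over `z` stays inside the prime ideal of `y`. -/
lemma exists_map_ne_top_of_ne_top {Z : Scheme.{u}} [IsAffine Z] {I : Ideal Γ(Z, ⊤)} (hI : I ≠ ⊤) :
    ∃ z : Z, ∀ (Y : Scheme.{u}) (_ : IsAffine Y) (f : Y ⟶ Z) (y : Y), f y = z →
      I.map f.appTop.hom ≠ ⊤ := by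
  obtain ⟨𝔪, hm, hle⟩ := Ideal.exists_le_maximal I hI
  let x : Spec Γ(Z, ⊤) := ⟨𝔪, hm.isPrime⟩
  refine ⟨Z.isoSpec.inv x, fun Y _ f y hy htop => ?_⟩
  have h1 := comap_isoSpec_hom f y
  rw [hy, show Z.isoSpec.hom (Z.isoSpec.inv x) = x from
    congr($(Z.isoSpec.inv_hom_id) x)] at h1
  have h2 : I.map f.appTop.hom ≤ (Y.isoSpec.hom y).asIdeal := by
    rw [Ideal.map_le_iff_le_comap]
    exact hle.trans (congr_arg PrimeSpectrum.asIdeal h1).ge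
  exact (Y.isoSpec.hom y).isPrime.ne_top (top_le_iff.1 (htop ▸ h2))

/-- An open subscheme of an étale `X`-scheme. -/
def opn (U : X.Etale) (W : U.left.Opens) : X.Etale := Scheme.Etale.mk (W.ι ≫ U.hom)

/-- The inclusion of an open subscheme of an étale `X`-scheme. -/
def opnι (U : X.Etale) (W : U.left.Opens) : opn U W ⟶ U :=
  MorphismProperty.Over.homMk W.ι rfl trivial

lemma etale_hom_ext {Y U : X.Etale} {g h : Y ⟶ U} (e : g.left = h.left) : g = h :=
  (Scheme.Etale.forget X).map_injective (Over.OverMorphism.ext e)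

lemma exists_hom_of_fac {Y U : X.Etale} (f : Y.left ⟶ U.left) (h : f ≫ U.hom = Y.hom) :
    ∃ g : Y ⟶ U, g.left = f :=
  ⟨MorphismProperty.Over.homMk f h trivial, rfl⟩

lemma exists_fac_opnι {Y U : X.Etale} (g : Y ⟶ U) (W : U.left.Opens)
    (h : ∀ y : Y.left, g.left y ∈ W) : ∃ g' : Y ⟶ opn U W, g' ≫ opnι U W = g := by
  obtain ⟨f, hf⟩ := exists_fac_ι g.left W h
  obtain ⟨g', hg'⟩ := exists_hom_of_fac (Y := Y) (U := opn U W) f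
    (by rw [← show g.left ≫ U.hom = Y.hom from Over.w g.hom, ← hf, Category.assoc]; rfl)
  refine ⟨g', etale_hom_ext ?_⟩
  rw [← hf, ← hg']
  rfl

lemma exists_affine_nbhd (U : X.Etale) (W : U.left.Opens) (u : U.left) (hu : u ∈ W) :
    ∃ W' : U.left.Opens, W' ≤ W ∧ IsAffineOpen W' ∧ u ∈ W' := by
  obtain ⟨_, ⟨W', hW', rfl⟩, h1, h2⟩ :=
    U.left.isBasis_affineOpens.exists_subset_of_mem_open hu W.2
  exact ⟨W', h2, hW', h1⟩

/-- Covering sieves contain sufficiently many morphisms from affine schemes. -/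
lemma exists_affine_of_mem_smallEtaleTopology {U : X.Etale} {S : Sieve U}
    (hS : S ∈ X.smallEtaleTopology U) (x : U.left) :
    ∃ (Y : X.Etale) (_ : IsAffine Y.left) (g : Y ⟶ U) (y : Y.left), S g ∧ g.left y = x := by
  obtain ⟨Y, g, y, hg, rfl⟩ := (mem_smallEtaleTopology_iff S).1 hS x
  obtain ⟨W, -, hW, hy⟩ := exists_affine_nbhd Y ⊤ y trivial
  exact ⟨opn Y W, hW, opnι Y W ≫ g, ⟨y, hy⟩, S.downward_closed hg _, rfl⟩

lemma etale_map {U V : X.Etale} (g : V ⟶ U) (hU : IsAffine U.left) (hV : IsAffine V.left) :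
    ((etaleO X).map g.op).hom.Etale :=
  etale_appTop g.left

lemma flat_map {U V : X.Etale} (g : V ⟶ U) (hU : IsAffine U.left) (hV : IsAffine V.left) :
    ((etaleO X).map g.op).hom.Flat :=
  flat_appTop g.left

lemma isLocalization_basicOpen {U : X.Etale} (hU : IsAffine U.left) (f : (etaleO X).obj (op U)) :
    @IsLocalization.Away _ _ f ((etaleO X).obj (op (opn U (U.left.basicOpen f)))) _
      ((etaleO X).map (opnι U (U.left.basicOpen f)).op).hom.toAlgebra :=
  (isAffineOpen_top U.left).isLocalization_of_eq_basicOpen f _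
    (TopologicalSpace.Opens.isOpenEmbedding_obj_top _)

lemma isAffine_opn_basicOpen {U : X.Etale} (hU : IsAffine U.left) (f : (etaleO X).obj (op U)) :
    IsAffine (opn U (U.left.basicOpen f)).left :=
  (isAffineOpen_top U.left).basicOpen f

end Site

/-! ### Restriction maps and étale-local membership -/

section Modules

variable {X : Scheme.{u}}
  (P : PresheafOfModules.{u} (etaleO X ⋙ forget₂ CommRingCat.{u} RingCat.{u}))

/-- The restriction map as a semilinear map. -/
def resL {U V : X.Etale} (g : V ⟶ U) : Sec P U →ₛₗ[((etaleO X).map g.op).hom] Sec P V :=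
  { res P g with map_smul' := res_smul P g }

variable {P}

lemma res_comp {U V W : X.Etale} (g : V ⟶ U) (h : W ⟶ V) (m : Sec P U) :
    res P (h ≫ g) m = res P h (res P g m) := by
  have := P.presheaf.map_comp g.op h.op
  exact congr($(this).hom m)

lemma res_id {U : X.Etale} (m : Sec P U) : res P (𝟙 U) m = m :=
  congr($(P.presheaf.map_id (op U)).hom m)

lemma onSec_res (F : P.presheaf ⟶ P.presheaf) {U V : X.Etale} (g : V ⟶ U) (m : Sec P U) :
    res P g (onSec P F U m) = onSec P F V (res P g m) :=
  congr($(F.naturality g.op).hom m).symm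

/-- Membership in a submodule of a quasi-coherent sheaf can be checked étale locally. -/
lemma mem_of_cover (hP : IsQuasicoherent P) {V : X.Etale} (hV : IsAffine V.left)
    (N : Submodule ((etaleO X).obj (op V)) (Sec P V)) (m : Sec P V) {S : Sieve V}
    (hS : S ∈ X.smallEtaleTopology V)
    (h : ∀ (Y : X.Etale) (g : Y ⟶ V), IsAffine Y.left → S g →
      res P g m ∈ Submodule.span ((etaleO X).obj (op Y)) (res P g '' N)) : m ∈ N := by
  set I := LinearMap.ker (LinearMap.toSpanSingleton ((etaleO X).obj (op V)) (Sec P V ⧸ N)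
    (N.mkQ m)) with hI
  suffices hI : I = ⊤ by
    have : (1 : (etaleO X).obj (op V)) ∈ I := hI ▸ trivial
    rwa [LinearMap.mem_ker, LinearMap.toSpanSingleton_apply, one_smul, N.mkQ_apply,
      Submodule.Quotient.mk_eq_zero] at this
  -- If the ideal `I` of multipliers taking `m` into `N` were proper, it would remain proper over
  -- any member of the cover hitting a suitable point, against `map_eq_top`.
  by_contra hne
  obtain ⟨x, hx⟩ := exists_map_ne_top_of_ne_top (Z := V.left) hne
  obtain ⟨Y, hY, g, y, hg, hyx⟩ := exists_affine_of_mem_smallEtaleTopology hS x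
  exact hx Y.left hY g.left y hyx
    ((hP g hV hY).map_eq_top (flat_map g hV hY) N m (h Y g hY hg))

end Modules

/-! ## Étale coordinates -/

section Coordinates

open Polynomial

/-- There is an étale ring map from the polynomial ring in one variable over a perfect field of
characteristic `p`. -/
def HasEtaleCoord (p : ℕ) (B : Type u) [CommRing B] : Prop :=
  ∃ (K : Type u) (_ : Field K) (_ : CharP K p) (_ : PerfectField K) (φ : K[X] →+* B), φ.Etale

/-- Condenses the chart to what is needed later: an element `x` whose powers remain a basis over
`q`-th powers in all étale `B`-algebras, and existence of minimal roots over `B`. -/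
lemma HasEtaleCoord.exists_coord {p r : ℕ} [Fact p.Prime] (hr : 0 < r) {B : Type u} [CommRing B]
    (h : HasEtaleCoord p B) : ∃ x : B,
      (∀ (B' : Type u) [CommRing B'] (ψ : B →+* B'), ψ.Etale → Function.Bijective
        fun b : Fin (p ^ r) → B' => ∑ i : Fin (p ^ r), ψ x ^ (i : ℕ) * b i ^ p ^ r) ∧
      ∀ (W : Type u) [AddCommGroup W] [Module B W] (F : W →+ W), FrobCoord (A := B) F (p ^ r) x →
        IsFrobFG (A := B) F → ∃ N : Submodule B W, IsMinRoot F N := by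
  obtain ⟨K, _, _, _, φ, hφ⟩ := h
  have hp : ((p : ℕ) : K[X]) = 0 := CharP.cast_eq_zero _ _
  refine ⟨φ X, fun B' _ ψ hψ => ?_, fun W _ _ F hF hfg => ?_⟩
  · let _ : Algebra K[X] B' := (ψ.comp φ).toAlgebra
    have : Algebra.Etale K[X] B' := RingHom.Etale.stableUnderComposition _ _ hφ hψ
    have := bijective_sum_pow_mul_pow_of_etale (p := p) (r := r) (B := B') hp
      (fun i : Fin (p ^ r) => (X : K[X]) ^ (i : ℕ)) (bijective_sum_X_pow_mul_pow K)
    simp only [map_pow] at this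
    exact this
  · let _ : Algebra K[X] B := φ.toAlgebra
    have : Algebra.Etale K[X] B := hφ
    exact FrobCoord.exists_isMinRoot_of_etale (K := K)
      ((Fact.out : p.Prime).two_le.trans (Nat.le_self_pow hr.ne' p)) hF hfg

lemma HasEtaleCoord.of_mvPolynomial {p : ℕ} {K R B : Type u} [Field K] [CharP K p] [PerfectField K]
    [CommRing R] [CommRing B] (e : K ≃+* R) (φ : MvPolynomial (Fin 1) R →+* B) (hφ : φ.Etale) :
    HasEtaleCoord p B :=
  ⟨K, inferInstance, inferInstance, inferInstance, φ.comp
    ((MvPolynomial.uniqueAlgEquiv K (Fin 1)).symm.toRingEquiv.trans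
      (MvPolynomial.mapEquiv (Fin 1) e)).toRingHom,
    RingHom.Etale.stableUnderComposition _ _
      (RingHom.Etale.of_bijective (RingEquiv.bijective _)) hφ⟩

lemma exists_isAffineOpen_hasEtaleCoord {X : Scheme.{u}} {k : Type u} [Field k] [PerfectField k]
    (p : ℕ) [CharP k p] (f : X ⟶ Spec (.of k)) [SmoothOfRelativeDimension 1 f] (x : X) :
    ∃ U : X.Opens, IsAffineOpen U ∧ x ∈ U ∧
      HasEtaleCoord p ((etaleO X).obj (op (Scheme.Etale.mk U.ι))) := by
  obtain ⟨V, -, U, hU, hx, e, hs⟩ :=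
    SmoothOfRelativeDimension.exists_isStandardSmoothOfRelativeDimension (n := 1) (f := f) x
  obtain ⟨g, -, hg⟩ := hs.exists_etale_mvPolynomial
  -- The spectrum of a field is a single point, so the affine open of the base in the smooth chart
  -- is everything.
  have hV : V = ⊤ := by
    ext y
    have : Subsingleton (Spec (.of k)) := inferInstanceAs (Subsingleton (PrimeSpectrum k))
    have hy := Subsingleton.elim y (f x)
    simp [hy, show f x ∈ V from e hx]
  subst hV
  refine ⟨U, hU, hx, HasEtaleCoord.of_mvPolynomial
    (Scheme.ΓSpecIso (.of k)).symm.commRingCatIsoToRingEquiv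
    (U.topIso.symm.commRingCatIsoToRingEquiv.toRingHom.comp g)
    (RingHom.Etale.stableUnderComposition _ _ hg
      (RingHom.Etale.of_bijective (RingEquiv.bijective _)))⟩

end Coordinates

/-! ## Good objects of the étale site -/

section Good

variable {X : Scheme.{u}}

/-- An affine étale `X`-scheme which maps to an affine open of `X` with an étale coordinate. -/
def IsGood (p : ℕ) (V : X.Etale) : Prop :=
  IsAffine V.left ∧ ∃ U : X.Opens, IsAffineOpen U ∧
    HasEtaleCoord p ((etaleO X).obj (op (Scheme.Etale.mk U.ι))) ∧
    Nonempty (V ⟶ Scheme.Etale.mk U.ι)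

lemma IsGood.of_hom {p : ℕ} {V V' : X.Etale} (h : IsGood p V) (g : V' ⟶ V)
    (hV' : IsAffine V'.left) : IsGood p V' :=
  ⟨hV', h.2.imp fun _ h => ⟨h.1, h.2.1, h.2.2.map (g ≫ ·)⟩⟩

lemma exists_isGood_opn {k : Type u} [Field k] [PerfectField k]
    (p : ℕ) [CharP k p] (f : X ⟶ Spec (.of k)) [SmoothOfRelativeDimension 1 f] (U : X.Etale)
    (W : U.left.Opens) (u : U.left) (hu : u ∈ W) :
    ∃ W' : U.left.Opens, W' ≤ W ∧ u ∈ W' ∧ ∀ W'' ≤ W', IsAffineOpen W'' →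
      IsGood p (opn U W'') := by
  obtain ⟨T, hT, hx, hc⟩ := exists_isAffineOpen_hasEtaleCoord p f (U.hom u)
  refine ⟨W ⊓ U.hom ⁻¹ᵁ T, inf_le_left, ⟨hu, hx⟩, fun W'' hle hW'' => ⟨hW'', T, hT, hc, ?_⟩⟩
  obtain ⟨h, hh⟩ := exists_fac_ι (W''.ι ≫ U.hom) T fun y => (hle y.2).2
  exact ⟨MorphismProperty.Over.homMk h hh trivial⟩

variable {k : Type u} [Field k] {p r : ℕ} [Fact p.Prime] [CharP k p]
  {f : X ⟶ Spec (.of k)} {M : OFModule X (p ^ r)}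

/-- Local finite generation concerns affine opens of `X`, so the minimal root is found over the
chart `U` and transported to `V` by base change; the coordinate is pulled back likewise. -/
lemma IsGood.exists_coord (hr : 0 < r) (hM : M.IsUnit f) (hfg : M.IsLocallyFG) {V : X.Etale}
    (hV : IsGood p V) :
    (∃ x : (etaleO X).obj (op V), ∀ (V' : X.Etale) (g : V' ⟶ V), IsAffine V'.left →
      FrobCoord (A := (etaleO X).obj (op V')) (M.frobSec V') (p ^ r)
        (((etaleO X).map g.op).hom x)) ∧
    ∃ N : Submodule ((etaleO X).obj (op V)) (Sec M.psh V), IsMinRoot (M.frobSec V) N := by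
  obtain ⟨hVa, U, hU, hc, ⟨j⟩⟩ := hV
  obtain ⟨x, hx, hroot⟩ := hc.exists_coord (r := r) hr
  have hUa : IsAffine (Scheme.Etale.mk U.ι).left := hU
  have key : ∀ (V' : X.Etale) (g : V' ⟶ Scheme.Etale.mk U.ι), IsAffine V'.left →
      FrobCoord (A := (etaleO X).obj (op V')) (M.frobSec V') (p ^ r)
        (((etaleO X).map g.op).hom x) := fun V' g hV' =>
    FrobCoord.of_isBaseChangeAlong (natCast_eq_zero p f V')
      (hx _ _ (etale_map g hUa hV')) (M.frobSec_smul V') (hM.bijective V' hV')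
  have hid : FrobCoord (A := (etaleO X).obj (op (Scheme.Etale.mk U.ι)))
      (M.frobSec (Scheme.Etale.mk U.ι)) (p ^ r) x := by
    have := key _ (𝟙 _) hUa
    rwa [op_id, (etaleO X).map_id] at this
  refine ⟨⟨((etaleO X).map j.op).hom x, fun V' g hV' => ?_⟩, ?_⟩
  · have := key V' (g ≫ j) hV'
    rwa [op_comp, (etaleO X).map_comp] at this
  · obtain ⟨N, hN⟩ := hroot _ (M.frobSec _) hid (hfg U hU)
    exact ⟨_, hN.baseChange (resL M.psh j) (onSec_res M.F j) hid (key V j hVa)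
      (hM.quasicoherent j hUa hVa).span_range⟩

end Good

/-! ## Submodules of quasi-coherent sheaves and bases of the étale site -/

section Basis

variable {X : Scheme.{u}}

/-- A class of affine étale `X`-schemes, stable under maps from affine étale `X`-schemes, such that
small affine open subschemes of any étale `X`-scheme belong to it. -/
structure IsEtaleBasis (G : X.Etale → Prop) : Prop where
  isAffine {V : X.Etale} : G V → IsAffine V.left
  of_hom {V V' : X.Etale} : G V → (V' ⟶ V) → IsAffine V'.left → G V'
  exists_opn (U : X.Etale) (W : U.left.Opens) (u : U.left) : u ∈ W →
    ∃ W' : U.left.Opens, W' ≤ W ∧ u ∈ W' ∧ ∀ W'' ≤ W', IsAffineOpen W'' → G (opn U W'')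

lemma isEtaleBasis_isGood {k : Type u} [Field k] [PerfectField k]
    (p : ℕ) [CharP k p] (f : X ⟶ Spec (.of k)) [SmoothOfRelativeDimension 1 f] :
    IsEtaleBasis (X := X) (IsGood p) :=
  ⟨fun h => h.1, fun h g h' => h.of_hom g h', exists_isGood_opn p f⟩

/-- The sieve of all morphisms with image in one of the given open subsets. -/
def opensSieve (U : X.Etale) (s : Set U.left.Opens) : Sieve U where
  arrows _ g := ∃ W ∈ s, ∀ y, g.left y ∈ W
  downward_closed := by
    rintro Y Z g ⟨W, hW, h⟩ e
    exact ⟨W, hW, fun y => h (e.left y)⟩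

lemma opensSieve_mem {U : X.Etale} {s : Set U.left.Opens} (hs : ∀ u : U.left, ∃ W ∈ s, u ∈ W) :
    opensSieve U s ∈ X.smallEtaleTopology U := by
  refine (mem_smallEtaleTopology_iff _).2 fun u => ?_
  obtain ⟨W, hW, hu⟩ := hs u
  exact ⟨opn U W, opnι U W, ⟨u, hu⟩, ⟨W, hW, fun y => y.2⟩, rfl⟩

variable {G : X.Etale → Prop} (hG : IsEtaleBasis G)

include hG in
lemma IsEtaleBasis.exists_basicOpen {U : X.Etale} (hU : IsAffine U.left) :
    ∃ t : Finset ((etaleO X).obj (op U)), (∀ f ∈ t, G (opn U (U.left.basicOpen f))) ∧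
      ∀ u : U.left, ∃ f ∈ t, u ∈ U.left.basicOpen f := by
  have key : ∀ u : U.left, ∃ f : (etaleO X).obj (op U), G (opn U (U.left.basicOpen f)) ∧
      u ∈ U.left.basicOpen f := fun u => by
    obtain ⟨W, -, hu, hW⟩ := hG.exists_opn U ⊤ u trivial
    obtain ⟨f, hf, huf⟩ := (isAffineOpen_top U.left).exists_basicOpen_le ⟨u, hu⟩ trivial
    exact ⟨f, hW _ hf ((isAffineOpen_top U.left).basicOpen f), huf⟩
  choose f hf hu using key
  have : CompactSpace U.left := inferInstance
  obtain ⟨s, hs⟩ := isCompact_univ.elim_finite_subcover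
    (fun u => (U.left.basicOpen (f u) : Set U.left)) (fun u => (U.left.basicOpen (f u)).2)
    (fun u _ => Set.mem_iUnion.2 ⟨u, hu u⟩)
  classical
  refine ⟨s.image f, fun g hg => ?_, fun u => ?_⟩
  · obtain ⟨u, -, rfl⟩ := Finset.mem_image.1 hg
    exact hf u
  · obtain ⟨v, hv, huv⟩ := Set.mem_iUnion₂.1 (hs (Set.mem_univ u))
    exact ⟨f v, Finset.mem_image_of_mem f hv, huv⟩

variable {P : PresheafOfModules.{u} (etaleO X ⋙ forget₂ CommRingCat.{u} RingCat.{u})}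

include hG in
lemma IsSubsheaf.le_of_basis {N N' : P.Submodule} (hN' : IsSubsheaf N')
    (h : ∀ V, G V → N.obj (op V) ≤ N'.obj (op V)) : N ≤ N' := by
  refine PresheafOfModules.Submodule.le_iff.2 ?_
  rintro ⟨U⟩ m hm
  refine hN' U m (opensSieve U {W | G (opn U W)}) (opensSieve_mem fun u => ?_) ?_
  · obtain ⟨W, -, hu, hW⟩ := hG.exists_opn U ⊤ u trivial
    obtain ⟨W', hle, hW', hu'⟩ := exists_affine_nbhd U W u hu
    exact ⟨W', hW _ hle hW', hu'⟩
  · rintro Y g ⟨W, hW, hg⟩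
    obtain ⟨g', rfl⟩ := exists_fac_opnι g W hg
    rw [res_comp]
    exact N'.map g'.op (h _ hW (N.map (opnι U W).op hm))

variable (G) in
/-- The extension to all étale `X`-schemes of a family of submodules on a basis. -/
def extend (Q : ∀ V : X.Etale, Submodule ((etaleO X).obj (op V)) (Sec P V)) : P.Submodule where
  obj U :=
    { carrier := {m : Sec P U.unop | ∀ (V : X.Etale) (g : V ⟶ U.unop), G V → res P g m ∈ Q V}
      zero_mem' := fun V g _ => by rw [map_zero]; exact zero_mem _
      add_mem' := fun ha hb V g hV => by rw [map_add]; exact add_mem (ha V g hV) (hb V g hV)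
      smul_mem' := fun a m hm V g hV => by
        have := (Q V).smul_mem (((etaleO X).map g.op).hom a) (hm V g hV)
        rwa [← res_smul] at this }
  map f m hm V g hV := by
    have := hm V (g ≫ f.unop) hV
    rwa [res_comp] at this

section Compatible

variable {Q : ∀ V : X.Etale, Submodule ((etaleO X).obj (op V)) (Sec P V)}
  (hQ : ∀ (V V' : X.Etale) (g : V' ⟶ V), G V → G V' →
    Submodule.span ((etaleO X).obj (op V')) (res P g '' Q V) = Q V')

include hQ

lemma extend_obj {V : X.Etale} (hV : G V) : (extend G Q).obj (op V) = Q V := by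
  ext m
  refine ⟨fun h => by simpa only [res_id] using h V (𝟙 V) hV, fun h V' g hV' => ?_⟩
  rw [← hQ V V' g hV hV']
  exact Submodule.subset_span ⟨m, h, rfl⟩

include hG in
-- Compatibility of `Q` with restriction lets `mem_of_cover` test membership in `Q V` on a cover.
lemma isSubsheaf_extend (hP : IsQuasicoherent P) : IsSubsheaf (extend G Q) := by
  intro U m S hS h V g hV
  refine mem_of_cover hP (hG.isAffine hV) _ _ (X.smallEtaleTopology.pullback_stable g hS)
    fun Y e hY he => ?_
  have hY' := hG.of_hom hV e hY
  rw [hQ V Y e hV hY', ← res_comp, ← extend_obj hQ hY']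
  exact h Y _ he

end Compatible

/-! ### Coherence -/

section Coherence

lemma IsBaseChangeAlong.exists_pow_smul_eq {A B : Type*} [CommRing A] [CommRing B] {φ : A →+* B}
    {W W' : Type*} [AddCommGroup W] [Module A W] [AddCommGroup W'] [Module B W'] {g : W →+ W'}
    {hg : ∀ (a : A) (w : W), g (a • w) = φ a • g w} (h : IsBaseChangeAlong φ g hg) (f : A)
    (hf : @IsLocalization.Away _ _ f B _ φ.toAlgebra) (w : W') :
    ∃ (n : ℕ) (v : W), g v = φ f ^ n • w := by
  have hw : w ∈ Submodule.span B (Set.range g) := h.span_range ▸ trivial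
  induction hw using Submodule.span_induction with
  | mem w hw => exact ⟨0, hw.imp fun v hv => by rw [hv, pow_zero, one_smul]⟩
  | zero => exact ⟨0, 0, by simp⟩
  | add w w' _ _ hw hw' =>
    obtain ⟨n, v, hv⟩ := hw
    obtain ⟨n', v', hv'⟩ := hw'
    refine ⟨n + n', f ^ n' • v + f ^ n • v', ?_⟩
    rw [map_add, hg, hg, hv, hv', map_pow, map_pow, ← mul_smul, ← mul_smul, ← pow_add, ← pow_add,
      smul_add, add_comm n']
  | smul b w _ hw =>
    obtain ⟨n, v, hv⟩ := hw
    let _ : Algebra A B := φ.toAlgebra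
    obtain ⟨m, a, ha⟩ := IsLocalization.Away.surj f b
    refine ⟨m + n, a • v, ?_⟩
    rw [hg, hv, ← mul_smul, ← mul_smul, show φ a = b * φ f ^ m from ha.symm]
    ring_nf

lemma exists_pow_mem_of_map_eq_top {A B : Type*} [CommRing A] [CommRing B] {φ : A →+* B} {f : A}
    (hf : @IsLocalization.Away _ _ f B _ φ.toAlgebra) {I : Ideal A} (h : I.map φ = ⊤) :
    ∃ n : ℕ, f ^ n ∈ I := by
  let _ : Algebra A B := φ.toAlgebra
  by_contra! hc
  refine (IsLocalization.map_algebraMap_ne_top_iff_disjoint (Submonoid.powers f) B I).2 ?_ h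
  rw [Set.disjoint_left]
  rintro _ ⟨n, rfl⟩
  exact hc n

variable (hP : IsQuasicoherent P) {N : P.Submodule}
  (hN : ∀ (V V' : X.Etale) (g : V' ⟶ V), G V → G V' →
    Submodule.span ((etaleO X).obj (op V')) (res P g '' N.obj (op V)) = N.obj (op V'))

include hG hP hN

/-- Inside the basis member `D(a)`, the ideal of multipliers taking `m` into `N` becomes the unit
ideal once `f` is inverted, so it contains a power of `f`. -/
lemma exists_pow_smul_res_mem {U : X.Etale} {f a : (etaleO X).obj (op U)}
    (ha : G (opn U (U.left.basicOpen a))) {m : Sec P U}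
    (hm : res P (opnι U (U.left.basicOpen f)) m ∈ N.obj (op (opn U (U.left.basicOpen f)))) :
    ∃ n : ℕ, res P (opnι U (U.left.basicOpen a)) (f ^ n • m) ∈
      N.obj (op (opn U (U.left.basicOpen a))) := by
  set V := opn U (U.left.basicOpen a) with hV
  set j := opnι U (U.left.basicOpen a)
  have hVa := hG.isAffine ha
  let f' : (etaleO X).obj (op V) := ((etaleO X).map j.op).hom f
  have hD := isAffine_opn_basicOpen hVa f'
  have hloc := isLocalization_basicOpen hVa f'
  set e := opnι V (V.left.basicOpen f')
  obtain ⟨e', he'⟩ := exists_fac_opnι (e ≫ j) (U.left.basicOpen f) fun y => by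
    have h1 : (e.left y) ∈ V.left.basicOpen f' := y.2
    have h2 : V.left.basicOpen f' ≤ j.left ⁻¹ᵁ U.left.basicOpen f :=
      (Scheme.preimage_basicOpen j.left f).ge
    exact h2 h1
  have hDG : G (opn V (V.left.basicOpen f')) := hG.of_hom ha e hD
  have h1 : res P e (res P j m) ∈
      Submodule.span ((etaleO X).obj (op (opn V (V.left.basicOpen f'))))
        (res P e '' N.obj (op V)) := by
    rw [hN V _ e ha hDG, ← res_comp, ← he', res_comp]
    exact N.map e'.op hm
  obtain ⟨n, hn⟩ := exists_pow_mem_of_map_eq_top hloc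
    ((hP e hVa hD).map_eq_top (flat_map e hVa hD) (N.obj (op V)) (res P j m) h1)
  refine ⟨n, ?_⟩
  rw [LinearMap.mem_ker, LinearMap.toSpanSingleton_apply, ← map_smul, Submodule.mkQ_apply,
    Submodule.Quotient.mk_eq_zero] at hn
  rw [res_smul, map_pow]
  exact hn

variable (hsub : IsSubsheaf N)
include hsub

/-- Clear denominators first in `P`, then in `N` on each of finitely many basic opens covering `U`.
The largest exponent works on all of them, and the sheaf condition gives membership over `U`. This
reaches affine `U` outside the basis. -/
lemma exists_mem_res_eq {U : X.Etale} (hU : IsAffine U.left) {f : (etaleO X).obj (op U)}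
    (hf : G (opn U (U.left.basicOpen f))) {m : Sec P (opn U (U.left.basicOpen f))}
    (hm : m ∈ N.obj (op (opn U (U.left.basicOpen f)))) :
    ∃ (n : ℕ) (m' : Sec P U), m' ∈ N.obj (op U) ∧ res P (opnι U (U.left.basicOpen f)) m' =
      ((etaleO X).map (opnι U (U.left.basicOpen f)).op).hom f ^ n • m := by
  obtain ⟨n, m', hm'⟩ := (hP (opnι U (U.left.basicOpen f)) hU
    (hG.isAffine hf)).exists_pow_smul_eq f (isLocalization_basicOpen hU f) m
  obtain ⟨t, ht, hcov⟩ := hG.exists_basicOpen hU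
  have hmem : res P (opnι U (U.left.basicOpen f)) m' ∈
      N.obj (op (opn U (U.left.basicOpen f))) := by
    rw [hm']
    exact Submodule.smul_mem _ _ hm
  choose! b hb using fun a (ha : a ∈ t) =>
    exists_pow_smul_res_mem hG hP hN (ht a ha) hmem
  refine ⟨t.sup b + n, f ^ t.sup b • m', ?_, ?_⟩
  · refine hsub U _ (opensSieve U {W | ∃ a ∈ t, W = U.left.basicOpen a}) (opensSieve_mem
      fun u => ?_) ?_
    · obtain ⟨a, ha, hu⟩ := hcov u
      exact ⟨_, ⟨a, ha, rfl⟩, hu⟩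
    · rintro Y g ⟨_, ⟨a, ha, rfl⟩, hg⟩
      obtain ⟨g', rfl⟩ := exists_fac_opnι g _ hg
      rw [res_comp]
      refine N.map g'.op ?_
      obtain ⟨c, hc⟩ := Nat.exists_eq_add_of_le (Finset.le_sup (f := b) ha)
      rw [hc, add_comm, pow_add, mul_smul, res_smul]
      exact Submodule.smul_mem _ _ (hb a ha)
  · rw [res_smul, hm', map_pow, ← mul_smul, ← pow_add]

lemma span_res_basicOpen {U : X.Etale} (hU : IsAffine U.left) {f : (etaleO X).obj (op U)}
    (hf : G (opn U (U.left.basicOpen f))) :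
    Submodule.span ((etaleO X).obj (op (opn U (U.left.basicOpen f))))
      (res P (opnι U (U.left.basicOpen f)) '' N.obj (op U)) =
        N.obj (op (opn U (U.left.basicOpen f))) := by
  refine le_antisymm (Submodule.span_le.2 ?_) fun m hm => ?_
  · rintro _ ⟨m, hm, rfl⟩
    exact N.map _ hm
  · obtain ⟨n, m', hm', h⟩ := exists_mem_res_eq hG hP hN hsub hU hf hm
    let _ := ((etaleO X).map (opnι U (U.left.basicOpen f)).op).hom.toAlgebra
    have hloc := isLocalization_basicOpen hU f
    have hu : IsUnit (((etaleO X).map (opnι U (U.left.basicOpen f)).op).hom f ^ n) :=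
      (IsLocalization.Away.algebraMap_isUnit f).pow n
    rw [← Submodule.smul_mem_iff_of_isUnit _ hu, ← h]
    exact Submodule.subset_span ⟨m', hm', rfl⟩

/-- Locally on `V` the map factors through a basis member `D(a)` in `U`. Sections there are
generated by those over `U` by localization, and sections further down by those over `D(a)` by the
hypothesis on the basis. -/
lemma span_res_eq {U V : X.Etale} (g : V ⟶ U) (hU : IsAffine U.left) (hV : IsAffine V.left) :
    Submodule.span ((etaleO X).obj (op V)) (res P g '' N.obj (op U)) = N.obj (op V) := by
  refine le_antisymm (Submodule.span_le.2 ?_) fun m hm => ?_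
  · rintro _ ⟨m, hm, rfl⟩
    exact N.map _ hm
  obtain ⟨t, ht, hcov⟩ := hG.exists_basicOpen hU
  refine mem_of_cover hP hV _ m (X.smallEtaleTopology.pullback_stable g
    (opensSieve_mem (s := {W | ∃ a ∈ t, W = U.left.basicOpen a}) fun u => ?_)) ?_
  · obtain ⟨a, ha, hu⟩ := hcov u
    exact ⟨_, ⟨a, ha, rfl⟩, hu⟩
  · rintro Y e hY ⟨_, ⟨a, ha, rfl⟩, hg⟩
    obtain ⟨g', hg'⟩ := exists_fac_opnι (e ≫ g) _ hg
    have h1 : res P e m ∈ N.obj (op Y) := N.map e.op hm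
    rw [← hN _ Y g' (ht a ha) (hG.of_hom (ht a ha) g' hY),
      ← span_res_basicOpen hG hP hN hsub hU (ht a ha)] at h1
    refine (Submodule.span_le (R := (etaleO X).obj (op Y))).2 ?_ h1
    rintro _ ⟨w, hw, rfl⟩
    have h2 : res P g' w ∈ Submodule.span ((etaleO X).obj (op Y))
        (resL P g' '' (res P (opnι U (U.left.basicOpen a)) '' N.obj (op U))) := by
      rw [← span_image_span (resL P g')]
      exact Submodule.subset_span ⟨w, hw, rfl⟩
    refine Submodule.span_mono ?_ h2
    rintro _ ⟨_, ⟨v, hv, rfl⟩, rfl⟩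
    refine ⟨res P g v, Submodule.subset_span ⟨v, hv, rfl⟩, ?_⟩
    change _ = res P g' (res P _ v)
    rw [← res_comp, ← res_comp, hg']

lemma fg_obj (hfg : ∀ V, G V → (N.obj (op V) : Submodule ((etaleO X).obj (op V)) (Sec P V)).FG)
    {U : X.Etale} (hU : IsAffine U.left) :
    (N.obj (op U) : Submodule ((etaleO X).obj (op U)) (Sec P U)).FG := by
  classical
  obtain ⟨t, ht, hcov⟩ := hG.exists_basicOpen hU
  have key : ∀ a ∈ t, ∃ s : Finset (Sec P U), (s : Set (Sec P U)) ⊆ N.obj (op U) ∧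
      Submodule.span ((etaleO X).obj (op (opn U (U.left.basicOpen a))))
        (res P (opnι U (U.left.basicOpen a)) '' s) =
          N.obj (op (opn U (U.left.basicOpen a))) := fun a ha => by
    have h1 := hfg _ (ht a ha)
    rw [← span_res_basicOpen hG hP hN hsub hU (ht a ha)] at h1
    -- Finitely many local generators can be chosen among restrictions of sections over `U`; those
    -- for all members of the cover then generate together, by descent.
    obtain ⟨s', hs', hspan⟩ := (Submodule.fg_span_iff_fg_span_finset_subset _).1 h1
    obtain ⟨s, hs, rfl⟩ := Finset.subset_set_image_iff.1 hs'
    refine ⟨s, hs, ?_⟩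
    rw [← span_res_basicOpen hG hP hN hsub hU (ht a ha), ← Finset.coe_image]
    exact hspan.symm
  choose! s hs hspan using key
  refine ⟨t.biUnion s, le_antisymm (Submodule.span_le.2 fun m hm => ?_) fun m hm => ?_⟩
  · obtain ⟨a, ha, hm⟩ := Finset.mem_biUnion.1 hm
    exact hs a ha hm
  · refine mem_of_cover hP hU _ m
      (opensSieve_mem (s := {W | ∃ a ∈ t, W = U.left.basicOpen a}) fun u => ?_) ?_
    · obtain ⟨a, ha, hu⟩ := hcov u
      exact ⟨_, ⟨a, ha, rfl⟩, hu⟩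
    · rintro Y e hY ⟨_, ⟨a, ha, rfl⟩, hg⟩
      obtain ⟨g', rfl⟩ := exists_fac_opnι e _ hg
      have h1 : res P (opnι U (U.left.basicOpen a)) m ∈ N.obj (op (opn U _)) := N.map _ hm
      rw [← hspan a ha] at h1
      have h2 : res P g' (res P (opnι U (U.left.basicOpen a)) m) ∈ Submodule.span ((etaleO X).obj (op Y))
          (resL P g' '' (res P (opnι U (U.left.basicOpen a)) '' s a)) := by
        rw [← span_image_span (resL P g')]
        exact Submodule.subset_span ⟨_, h1, rfl⟩
      rw [res_comp]
      refine Submodule.span_mono ?_ h2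
      rintro _ ⟨_, ⟨v, hv, rfl⟩, rfl⟩
      refine ⟨v, Submodule.subset_span (Finset.mem_biUnion.2 ⟨a, ha, hv⟩), ?_⟩
      rw [res_comp]
      rfl

/-- A subsheaf of a quasi-coherent sheaf is coherent if it is so on a basis. -/
lemma isCoherent_toPresheafOfModules
    (hfg : ∀ V, G V → (N.obj (op V) : Submodule ((etaleO X).obj (op V)) (Sec P V)).FG) :
    IsCoherent N.toPresheafOfModules where
  quasicoherent U V g hU hV :=
    (hP g hU hV).restrict (flat_map g hU hV) (N.obj (op U)) (N.obj (op V))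
      (span_res_eq hG hP hN hsub g hU hV) (res N.toPresheafOfModules g) _ fun _ => rfl
  finite _ hU := Module.Finite.iff_fg.2 (fg_obj hG hP hN hsub hfg hU)

end Coherence

/-- Sections over affine schemes of a quasi-coherent submodule are generated by restrictions. -/
lemma span_res_of_isQuasicoherent {N : P.Submodule} (h : IsQuasicoherent N.toPresheafOfModules)
    {U V : X.Etale} (g : V ⟶ U) (hU : IsAffine U.left) (hV : IsAffine V.left) :
    Submodule.span ((etaleO X).obj (op V)) (res P g '' N.obj (op U)) = N.obj (op V) := by
  refine le_antisymm (Submodule.span_le.2 ?_) fun m hm => ?_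
  · rintro _ ⟨m, hm, rfl⟩
    exact N.map _ hm
  have h1 := (h g hU hV).span_range
  have key : ∀ n : Sec N.toPresheafOfModules V,
      n ∈ Submodule.span ((etaleO X).obj (op V)) (Set.range (res N.toPresheafOfModules g)) →
      (n : N.obj (op V)).1 ∈ Submodule.span ((etaleO X).obj (op V)) (res P g '' N.obj (op U)) := by
    intro n hn
    induction hn using Submodule.span_induction with
    | mem n hn =>
      obtain ⟨w, rfl⟩ := hn
      exact Submodule.subset_span ⟨_, (w : N.obj (op U)).2, rfl⟩
    | zero => exact zero_mem _
    | add a b _ _ ha hb => exact add_mem ha hb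
    | smul a b _ hb => exact Submodule.smul_mem _ a hb
  exact key ⟨m, hm⟩ (h1 ▸ trivial)

end Basis

/-! ## The minimal root sheaf -/

section Roots

variable {X : Scheme.{u}} {q : ℕ} {M : OFModule X q} {G : X.Etale → Prop}

namespace OFModule

lemma span_res_spanF {U V : X.Etale} (g : V ⟶ U)
    (N : Submodule ((etaleO X).obj (op U)) (Sec M.psh U)) :
    Submodule.span ((etaleO X).obj (op V)) (res M.psh g '' spanF (M.frobSec U) N) =
      spanF (M.frobSec V) (Submodule.span ((etaleO X).obj (op V)) (res M.psh g '' N)) :=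
  span_image_spanF (resL M.psh g) (onSec_res M.F g) N ⟨q, M.frobSec_smul V⟩

lemma span_res_frobSpan {U V : X.Etale} (g : V ⟶ U)
    (N : Submodule ((etaleO X).obj (op U)) (Sec M.psh U))
    (N' : Submodule ((etaleO X).obj (op V)) (Sec M.psh V))
    (h : Submodule.span ((etaleO X).obj (op V)) (res M.psh g '' N) = N') :
    Submodule.span ((etaleO X).obj (op V))
      (res M.psh g '' frobSpan (A := (etaleO X).obj (op U)) (M.frobSec U) N) =
        frobSpan (M.frobSec V) N' := by
  refine le_antisymm (Submodule.span_le.2 (image_frobSpan_subset (resL M.psh g)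
    (onSec_res M.F g) (N : Set (Sec M.psh U)) ?_)) (frobSpan_le ?_ fun w hw => ?_)
  · rw [← h]
    exact Submodule.subset_span
  · rw [← h]
    exact Submodule.span_mono (Set.image_mono (subset_frobSpan _))
  · induction hw using Submodule.span_induction with
    | mem w hw =>
      obtain ⟨v, hv, rfl⟩ := hw
      exact Submodule.subset_span ⟨_, map_mem_frobSpan hv, onSec_res M.F g v⟩
    | zero => rw [map_zero]; exact zero_mem _
    | add a b _ _ ha hb => rw [map_add]; exact add_mem ha hb
    | smul a b _ hb => rw [M.frobSec_smul]; exact Submodule.smul_mem _ _ hb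

/-- The sections of a root over the members of a basis are roots. -/
lemma IsRoot.isRoot_obj (hG : IsEtaleBasis G) (hM : IsQuasicoherent M.psh) {N : M.psh.Submodule}
    (hN : M.IsRoot N) {V : X.Etale} (hV : G V) :
    FrobMod.IsRoot (A := (etaleO X).obj (op V)) (M.frobSec V) (N.obj (op V)) := by
  have hres : ∀ (V V' : X.Etale) (g : V' ⟶ V), G V → G V' →
      Submodule.span ((etaleO X).obj (op V')) (res M.psh g '' N.obj (op V)) = N.obj (op V') :=
    fun V V' g hV hV' => span_res_of_isQuasicoherent hN.coherent.quasicoherent g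
      (hG.isAffine hV) (hG.isAffine hV')
  refine ⟨Module.Finite.iff_fg.1 (hN.coherent.finite V (hG.isAffine hV)), ?_, ?_⟩
  · let Q := fun V : X.Etale =>
      spanF (A := (etaleO X).obj (op V)) (M.frobSec V) (N.obj (op V))
    have hQ : ∀ (V V' : X.Etale) (g : V' ⟶ V), G V → G V' →
        Submodule.span ((etaleO X).obj (op V')) (res M.psh g '' Q V) = Q V' :=
      fun V V' g hV hV' => by
        change _ = spanF (M.frobSec V') (N.obj (op V'))
        rw [← hres V V' g hV hV']
        exact span_res_spanF g _
    have h1 : M.spanFrob N ≤ extend G Q := sInf_le ⟨isSubsheaf_extend hG hQ hM, by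
      intro U m hm V g hV
      rw [show res M.psh g (M.frobSec U m) = M.frobSec V (res M.psh g m) from onSec_res M.F g m]
      exact mem_spanF (N.map g.op hm)⟩
    have h2 : N.obj (op V) ≤ (extend G Q).obj (op V) := (hN.le_spanFrob.trans h1) (op V)
    rwa [extend_obj hQ hV] at h2
  · let Q := fun V : X.Etale =>
      frobSpan (A := (etaleO X).obj (op V)) (M.frobSec V) (N.obj (op V))
    have hQ : ∀ (V V' : X.Etale) (g : V' ⟶ V), G V → G V' →
        Submodule.span ((etaleO X).obj (op V')) (res M.psh g '' Q V) = Q V' :=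
      fun V V' g hV hV' => span_res_frobSpan g _ _ (hres V V' g hV hV')
    have h1 : M.generated N ≤ extend G Q := sInf_le ⟨isSubsheaf_extend hG hQ hM,
      fun U m hm V g hV => subset_frobSpan _ (N.map g.op hm), fun U m hm V g hV => by
        rw [show res M.psh g (M.frobSec U m) = M.frobSec V (res M.psh g m) from onSec_res M.F g m]
        exact map_mem_frobSpan (hm V g hV)⟩
    rw [hN.generated_eq_top] at h1
    have h2 : (⊤ : Submodule ((etaleO X).obj (op V)) (Sec M.psh V)) ≤ (extend G Q).obj (op V) :=
      h1 (op V)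
    rw [extend_obj hQ hV] at h2
    exact top_le_iff.1 h2

/-- A subsheaf whose sections over the members of a basis are roots is a root. -/
lemma isRoot_of_basis (hG : IsEtaleBasis G) (hM : IsQuasicoherent M.psh) {N : M.psh.Submodule}
    (hsub : IsSubsheaf N)
    (hN : ∀ (V V' : X.Etale) (g : V' ⟶ V), G V → G V' →
      Submodule.span ((etaleO X).obj (op V')) (res M.psh g '' N.obj (op V)) = N.obj (op V'))
    (h : ∀ V, G V →
      FrobMod.IsRoot (A := (etaleO X).obj (op V)) (M.frobSec V) (N.obj (op V))) :
    M.IsRoot N where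
  isSubsheaf := hsub
  coherent := isCoherent_toPresheafOfModules hG hM hN hsub fun V hV => (h V hV).fg
  le_spanFrob := le_sInf fun N' hN' => hN'.1.le_of_basis hG fun V hV =>
    (h V hV).le_span.trans <| Submodule.span_le.2 <| by
      rintro _ ⟨m, hm, rfl⟩
      exact hN'.2 V m hm
  generated_eq_top := top_le_iff.1 <| le_sInf fun N' hN' => hN'.1.le_of_basis hG fun V hV =>
    (h V hV).frobSpan_eq_top.ge.trans (frobSpan_le (hN'.2.1 (op V)) (hN'.2.2 V))

end OFModule

end Roots

/-! ### Gluing the local minimal roots -/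

section Main

variable {X : Scheme.{u}} {k : Type u} [Field k] {p r : ℕ} [Fact p.Prime] [CharP k p]
  {f : X ⟶ Spec (.of k)} {M : OFModule X (p ^ r)}

/-- The base change of `N` is a minimal root over `V'`, and minimal roots are unique. -/
lemma IsGood.span_res_eq (hr : 0 < r) (hM : M.IsUnit f) (hfg : M.IsLocallyFG) {V V' : X.Etale}
    (hV : IsGood p V) (hV' : IsAffine V'.left) (g : V' ⟶ V)
    {N : Submodule ((etaleO X).obj (op V)) (Sec M.psh V)} (hN : IsMinRoot (M.frobSec V) N)
    {N' : Submodule ((etaleO X).obj (op V')) (Sec M.psh V')} (hN' : IsMinRoot (M.frobSec V') N') :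
    Submodule.span ((etaleO X).obj (op V')) (res M.psh g '' N) = N' := by
  obtain ⟨x, hx⟩ := (hV.exists_coord hr hM hfg).1
  have h1 := hx V (𝟙 V) hV.1
  rw [op_id, (etaleO X).map_id] at h1
  have h2 := hN.baseChange (resL M.psh g) (onSec_res M.F g) h1 (hx V' g hV')
    (hM.quasicoherent g hV.1 hV').span_range
  exact h2.unique hN'

variable [PerfectField k] [SmoothOfRelativeDimension 1 f]

lemma exists_isRoot_isMinRoot (hr : 0 < r) (hM : M.IsUnit f) (hfg : M.IsLocallyFG) :
    ∃ M₀ : M.psh.Submodule, M.IsRoot M₀ ∧ ∀ V : X.Etale, IsGood p V →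
      IsMinRoot (A := (etaleO X).obj (op V)) (M.frobSec V) (M₀.obj (op V)) := by
  have hG := isEtaleBasis_isGood p f
  have key : ∀ V : X.Etale, ∃ N : Submodule ((etaleO X).obj (op V)) (Sec M.psh V),
      IsGood p V → IsMinRoot (M.frobSec V) N := fun V => by
    by_cases hV : IsGood p V
    · exact (hV.exists_coord hr hM hfg).2.imp fun N hN _ => hN
    · exact ⟨⊥, fun h => absurd h hV⟩
  choose Q hmin using key
  have hQ : ∀ (V V' : X.Etale) (g : V' ⟶ V), IsGood p V → IsGood p V' →
      Submodule.span ((etaleO X).obj (op V')) (res M.psh g '' Q V) = Q V' :=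
    fun V V' g hV hV' => hV.span_res_eq hr hM hfg hV'.1 g (hmin V hV) (hmin V' hV')
  have hobj : ∀ V : X.Etale, IsGood p V → IsMinRoot (A := (etaleO X).obj (op V)) (M.frobSec V)
      ((extend (IsGood p) Q).obj (op V)) := fun V hV => by
    rw [extend_obj hQ hV]
    exact hmin V hV
  refine ⟨extend (IsGood p) Q, ?_, hobj⟩
  refine OFModule.isRoot_of_basis hG hM.quasicoherent
    (isSubsheaf_extend hG hQ hM.quasicoherent) (fun V V' g hV hV' => ?_) fun V hV => (hobj V hV).1
  rw [extend_obj hQ hV, extend_obj hQ hV']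
  exact hQ V V' g hV hV'

lemma le_of_isRoot (hM : M.IsUnit f) {M₀ N : M.psh.Submodule}
    (h : ∀ V : X.Etale, IsGood p V →
      IsMinRoot (A := (etaleO X).obj (op V)) (M.frobSec V) (M₀.obj (op V))) (hN : M.IsRoot N) :
    M₀ ≤ N :=
  have hG := isEtaleBasis_isGood p f
  hN.isSubsheaf.le_of_basis hG fun V hV =>
    (h V hV).le (hN.isRoot_obj hG hM.quasicoherent hV)

end Main

/-! ## Stalks -/

section Stalks

variable {X : Scheme.{u}} {Ω : Type u} [Field Ω] [IsSepClosed Ω] (x : Spec (.of Ω) ⟶ X)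

/-! ### Étale neighbourhoods in a basis -/

section Neighbourhoods

variable {G : X.Etale → Prop} (hG : IsEtaleBasis G)

include hG

lemma IsEtaleBasis.exists_nbhd {U : X.Etale} (u : (Scheme.pointSmallEtale x).fiber.obj U) :
    ∃ (V : X.Etale) (g : V ⟶ U) (v : (Scheme.pointSmallEtale x).fiber.obj V), G V ∧
      (Scheme.pointSmallEtale x).fiber.map g v = u := by
  obtain ⟨Y, g, ⟨W, hW, hg⟩, y, hy⟩ := (Scheme.pointSmallEtale x).jointly_surjective
    (opensSieve U {W | G (opn U W)}) (opensSieve_mem fun u => by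
      obtain ⟨W, -, hu, hW⟩ := hG.exists_opn U ⊤ u trivial
      obtain ⟨W', hle, hW', hu'⟩ := exists_affine_nbhd U W u hu
      exact ⟨W', hW _ hle hW', hu'⟩) u
  obtain ⟨g', rfl⟩ := exists_fac_opnι g W hg
  refine ⟨_, opnι U W, (Scheme.pointSmallEtale x).fiber.map g' y, hW, ?_⟩
  rw [← hy, Functor.map_comp]
  rfl

lemma IsEtaleBasis.exists_common_nbhd {ι : Type*} [Finite ι] (U : ι → X.Etale)
    (u : ∀ i, (Scheme.pointSmallEtale x).fiber.obj (U i)) :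
    ∃ (V : X.Etale) (v : (Scheme.pointSmallEtale x).fiber.obj V) (g : ∀ i, V ⟶ U i), G V ∧
      ∀ i, (Scheme.pointSmallEtale x).fiber.map (g i) v = u i := by
  classical
  have := Fintype.ofFinite ι
  obtain ⟨⟨W, w⟩, h⟩ := IsCofiltered.inf_objs_exists
    (C := (Scheme.pointSmallEtale x).fiber.Elements)
    (Finset.univ.image fun i => (⟨U i, u i⟩ : (Scheme.pointSmallEtale x).fiber.Elements))
  obtain ⟨V, g, v, hV, rfl⟩ := hG.exists_nbhd x w
  have h' : ∀ i, ∃ e : W ⟶ U i, (Scheme.pointSmallEtale x).fiber.map e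
      ((Scheme.pointSmallEtale x).fiber.map g v) = u i := fun i => by
    obtain ⟨e⟩ := h (Finset.mem_image_of_mem _ (Finset.mem_univ i))
    exact ⟨e.1, e.2⟩
  choose e he using h'
  refine ⟨V, v, fun i => g ≫ e i, hV, fun i => ?_⟩
  rw [Functor.map_comp]
  exact he i

lemma IsEtaleBasis.exists_common_nbhd₂ {U U' : X.Etale}
    (u : (Scheme.pointSmallEtale x).fiber.obj U) (u' : (Scheme.pointSmallEtale x).fiber.obj U') :
    ∃ (V : X.Etale) (v : (Scheme.pointSmallEtale x).fiber.obj V) (g : V ⟶ U) (g' : V ⟶ U'), G V ∧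
      (Scheme.pointSmallEtale x).fiber.map g v = u ∧
      (Scheme.pointSmallEtale x).fiber.map g' v = u' := by
  obtain ⟨⟨W, w⟩, ⟨e, he⟩, ⟨e', he'⟩, -⟩ :=
    IsCofilteredOrEmpty.cone_objs (C := (Scheme.pointSmallEtale x).fiber.Elements) ⟨U, u⟩ ⟨U', u'⟩
  obtain ⟨V, g, v, hV, rfl⟩ := hG.exists_nbhd x w
  refine ⟨V, v, g ≫ e, g ≫ e', hV, ?_, ?_⟩
  · rw [Functor.map_comp]
    exact he
  · rw [Functor.map_comp]
    exact he'

end Neighbourhoods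

namespace OFModule

variable {q : ℕ} (M : OFModule X q)

/-- The germ at `x` as a semilinear map. -/
def germL {U : X.Etale} (v : (Scheme.pointSmallEtale x).fiber.obj U) :
    Sec M.psh U →ₛₗ[germRing x v] M.stalk x :=
  { M.germ x v with map_smul' := M.germ_smul x v }

lemma germRing_map {U V : X.Etale} (g : V ⟶ U) (v : (Scheme.pointSmallEtale x).fiber.obj V)
    (s : (etaleO X).obj (op U)) :
    germRing x v (((etaleO X).map g.op).hom s) =
      germRing x ((Scheme.pointSmallEtale x).fiber.map g v) s :=
  congr($((Scheme.pointSmallEtale x).toPresheafFiber_w g v (etaleSheaf X).obj).hom s)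

lemma exists_germ (w : M.stalk x) : ∃ (U : X.Etale) (u : (Scheme.pointSmallEtale x).fiber.obj U)
    (m : Sec M.psh U), M.germ x u m = w := by
  obtain ⟨U, u, m, h⟩ :=
    (Scheme.pointSmallEtale x).toPresheafFiber_jointly_surjective (P := M.psh.presheaf) w
  exact ⟨U, u, m, h⟩

lemma exists_germRing (a : stalkRing x) : ∃ (U : X.Etale)
    (u : (Scheme.pointSmallEtale x).fiber.obj U) (s : (etaleO X).obj (op U)),
    germRing x u s = a := by
  obtain ⟨U, u, m, h⟩ :=
    (Scheme.pointSmallEtale x).toPresheafFiber_jointly_surjective (P := (etaleSheaf X).obj) a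
  exact ⟨U, u, m, h⟩

lemma germ_eq_iff {U : X.Etale} (u : (Scheme.pointSmallEtale x).fiber.obj U) (m m' : Sec M.psh U) :
    M.germ x u m = M.germ x u m' ↔ ∃ (V : X.Etale) (g : V ⟶ U)
      (v : (Scheme.pointSmallEtale x).fiber.obj V), (Scheme.pointSmallEtale x).fiber.map g v = u ∧
        res M.psh g m = res M.psh g m' := by
  refine ⟨fun h => ?_, ?_⟩
  · obtain ⟨V, g, v, hv, h⟩ := ((Scheme.pointSmallEtale x).toPresheafFiber_eq_iff'
      (P := M.psh.presheaf) U u m m').1 h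
    exact ⟨V, g, v, hv, h⟩
  · rintro ⟨V, g, v, rfl, h⟩
    rw [← germ_res, h, germ_res]

variable {G : X.Etale → Prop} (hG : IsEtaleBasis G)

include hG

lemma exists_germ_family {ι : Type*} [Finite ι] (w : ι → M.stalk x) :
    ∃ (U : X.Etale) (u : (Scheme.pointSmallEtale x).fiber.obj U) (m : ι → Sec M.psh U),
      ∀ i, M.germ x u (m i) = w i := by
  choose U u m hm using fun i => M.exists_germ x (w i)
  obtain ⟨V, v, g, -, hg⟩ := hG.exists_common_nbhd x U u
  refine ⟨V, v, fun i => res M.psh (g i) (m i), fun i => ?_⟩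
  rw [germ_res, hg, hm]

variable {M}

/-- Any germ of `N` is represented on a basis neighbourhood mapping to `V`, where the sections of
`N` are generated by those over `V`. -/
lemma span_germ_eq {V : X.Etale} (v : (Scheme.pointSmallEtale x).fiber.obj V)
    (N : M.psh.Submodule)
    (hN : ∀ (V' : X.Etale) (g : V' ⟶ V), G V' →
      Submodule.span ((etaleO X).obj (op V')) (res M.psh g '' N.obj (op V)) = N.obj (op V')) :
    Submodule.span (stalkRing x) (M.germ x v '' N.obj (op V)) = M.stalkSubmodule x N := by
  refine le_antisymm (Submodule.span_le.2 ?_) ?_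
  · rintro _ ⟨m, hm, rfl⟩
    exact ⟨V, v, m, hm, rfl⟩
  · rintro _ ⟨U, u, m, hm, rfl⟩
    obtain ⟨Y, y, g, g', hY, rfl, rfl⟩ := hG.exists_common_nbhd₂ x u v
    have h1 : res M.psh g m ∈ N.obj (op Y) := N.map g.op hm
    rw [← hN Y g' hY] at h1
    have h2 : M.germL x y (res M.psh g m) ∈
        Submodule.span (stalkRing x) (M.germL x y '' (res M.psh g' '' N.obj (op V))) := by
      rw [← span_image_span (M.germL x y)]
      exact Submodule.subset_span ⟨_, h1, rfl⟩
    rw [← germ_res]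
    refine Submodule.span_mono ?_ h2
    rintro _ ⟨_, ⟨n, hn, rfl⟩, rfl⟩
    exact ⟨n, hn, (M.germ_res x g' y n).symm⟩

/-- Finitely many germs and their relations live on one neighbourhood, so expansions in powers of
`t` pass to the filtered colimit. -/
lemma frobCoord_stalk {V : X.Etale} (v : (Scheme.pointSmallEtale x).fiber.obj V)
    (t : (etaleO X).obj (op V))
    (ht : ∀ (V' : X.Etale) (g : V' ⟶ V), G V' →
      FrobCoord (A := (etaleO X).obj (op V')) (M.frobSec V') q (((etaleO X).map g.op).hom t)) :
    FrobCoord (M.stalkFrob x) q (germRing x v t) := by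
  have hsum : ∀ (Y : X.Etale) (y : (Scheme.pointSmallEtale x).fiber.obj Y) (g : Y ⟶ V)
      (_ : (Scheme.pointSmallEtale x).fiber.map g y = v) (m : Fin q → Sec M.psh Y),
      M.germ x y (∑ i : Fin q, ((etaleO X).map g.op).hom t ^ (i : ℕ) • M.frobSec Y (m i)) =
        ∑ i : Fin q, germRing x v t ^ (i : ℕ) • M.stalkFrob x (M.germ x y (m i)) := by
    rintro Y y g rfl m
    rw [map_sum]
    refine Finset.sum_congr rfl fun i _ => ?_
    rw [stalkFrob_germ, ← germRing_map]
    exact (M.germ_smul x y _ _).trans (by rw [map_pow])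
  refine ⟨fun a w => ?_, fun a => ?_, fun w w' hw => ?_, fun w => ?_⟩
  · obtain ⟨U, u, s, rfl⟩ := exists_germRing x a
    obtain ⟨U', u', m, rfl⟩ := M.exists_germ x w
    obtain ⟨Y, y, g, g', hY, rfl, rfl⟩ := hG.exists_common_nbhd₂ x u u'
    rw [← germRing_map, ← germ_res, ← germ_smul, stalkFrob_germ, stalkFrob_germ, ← map_pow,
      ← germ_smul, frobSec_smul]
  · obtain ⟨U, u, s, rfl⟩ := exists_germRing x a
    obtain ⟨Y, y, g, g', hY, rfl, rfl⟩ := hG.exists_common_nbhd₂ x u v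
    obtain ⟨b, hb⟩ := (ht Y g' hY).span (((etaleO X).map g.op).hom s)
    refine ⟨fun i => germRing x y (b i), ?_⟩
    rw [← germRing_map, ← germRing_map, hb, map_sum]
    exact Finset.sum_congr rfl fun i _ => by rw [map_mul, map_pow, map_pow]
  · obtain ⟨U, u, m, hm⟩ := M.exists_germ_family x hG (Sum.elim w w')
    obtain ⟨Y, y, g, g', hY, rfl, hv⟩ := hG.exists_common_nbhd₂ x u v
    have h1 : ∀ i, w i = M.germ x y (res M.psh g (m (.inl i))) := fun i => by
      rw [germ_res]; exact (hm (.inl i)).symm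
    have h2 : ∀ i, w' i = M.germ x y (res M.psh g (m (.inr i))) := fun i => by
      rw [germ_res]; exact (hm (.inr i)).symm
    simp only [h1, h2] at hw
    rw [← hsum Y y g' hv, ← hsum Y y g' hv, germ_eq_iff] at hw
    obtain ⟨Z, e, z, rfl, hz⟩ := hw
    -- The two expansions agree on `Z`, but uniqueness of coefficients is only available on members
    -- of the basis.
    obtain ⟨Z', e', z', hZ', rfl⟩ := hG.exists_nbhd x z
    have h3 : ∀ n : Fin q → Sec M.psh Y, res M.psh e' (res M.psh e
        (∑ i : Fin q, ((etaleO X).map g'.op).hom t ^ (i : ℕ) • M.frobSec Y (n i))) =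
        ∑ i : Fin q, ((etaleO X).map ((e' ≫ e) ≫ g').op).hom t ^ (i : ℕ) •
          M.frobSec Z' (res M.psh (e' ≫ e) (n i)) := fun n => by
      rw [← res_comp, map_sum]
      refine Finset.sum_congr rfl fun i _ => ?_
      refine (res_smul M.psh (e' ≫ e) _ _).trans ?_
      rw [show res M.psh (e' ≫ e) (M.frobSec Y (n i)) = M.frobSec Z' (res M.psh (e' ≫ e) (n i))
        from onSec_res M.F _ _, map_pow, op_comp (g := g'), (etaleO X).map_comp]
      rfl
    have h4 := congr_arg (res M.psh e') hz
    rw [h3, h3] at h4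
    have h5 := (ht Z' ((e' ≫ e) ≫ g') hZ').bij.1 h4
    funext i
    have h6 : res M.psh (e' ≫ e) (res M.psh g (m (.inl i))) =
      res M.psh (e' ≫ e) (res M.psh g (m (.inr i))) := congr_fun h5 i
    rw [res_comp, res_comp] at h6
    rw [h1, h2, ← germ_res, ← germ_res, ← germ_res, ← germ_res, h6]
  · obtain ⟨U, u, m, rfl⟩ := M.exists_germ x w
    obtain ⟨Y, y, g, g', hY, rfl, hv⟩ := hG.exists_common_nbhd₂ x u v
    obtain ⟨n, hn⟩ := (ht Y g' hY).bij.2 (res M.psh g m)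
    refine ⟨fun i => M.germ x y (n i), ?_⟩
    exact (hsum Y y g' hv n).symm.trans ((congr_arg (M.germ x y) hn).trans (M.germ_res x g y m))

end OFModule

/-! ### Minimal roots of stalks -/

section Main

variable {x} {k : Type u} [Field k] {p r : ℕ} [Fact p.Prime] [CharP k p] [PerfectField k]
  {f : X ⟶ Spec (.of k)} [SmoothOfRelativeDimension 1 f] {M : OFModule X (p ^ r)}

/-- For one good neighbourhood `V`, the germ map is a base change that keeps the Frobenius
coordinate, so `IsMinRoot.baseChange` applies; the span of germs from `V` is the whole stalk of
`M₀`. -/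
lemma isMinRoot_stalkSubmodule (hr : 0 < r) (hM : M.IsUnit f) (hfg : M.IsLocallyFG)
    {M₀ : M.psh.Submodule} (h : ∀ V : X.Etale, IsGood p V →
      IsMinRoot (A := (etaleO X).obj (op V)) (M.frobSec V) (M₀.obj (op V))) :
    IsMinRoot (M.stalkFrob x) (M.stalkSubmodule x M₀) := by
  have hG := isEtaleBasis_isGood p f
  obtain ⟨⟨U, u⟩⟩ := IsCofiltered.nonempty (C := (Scheme.pointSmallEtale x).fiber.Elements)
  obtain ⟨V, -, v, hV, -⟩ := hG.exists_nbhd x u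
  obtain ⟨t, ht⟩ := (hV.exists_coord hr hM hfg).1
  have h1 := ht V (𝟙 V) hV.1
  rw [op_id, (etaleO X).map_id] at h1
  have h2 := OFModule.frobCoord_stalk x hG v t fun V' g hV' => ht V' g hV'.1
  have htop : Submodule.span (OFModule.stalkRing x) (Set.range (M.germL x v)) = ⊤ := by
    have := OFModule.span_germ_eq x hG v (⊤ : M.psh.Submodule) fun V' g hV' => by
      have := (hM.quasicoherent g hV.1 hV'.1).span_range
      rwa [← Set.image_univ] at this
    rw [eq_top_iff]
    intro w _
    obtain ⟨Y, y, m, rfl⟩ := M.exists_germ x w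
    have h3 : M.germ x y m ∈ M.stalkSubmodule x (⊤ : M.psh.Submodule) := ⟨Y, y, m, trivial, rfl⟩
    rw [← this] at h3
    exact Submodule.span_mono (Set.image_subset_range _ _) h3
  have h3 := (h V hV).baseChange (M.germL x v) (fun w => (M.stalkFrob_germ x v w).symm) h1 h2 htop
  rw [← OFModule.span_germ_eq x hG v M₀ fun V' g hV' =>
    hV.span_res_eq hr hM hfg hV'.1 g (h V hV) (h V' hV')]
  exact h3

end Main

end Stalks

end FrobMod

end

/-- Minimal roots on a smooth curve. -/
theorem mainTheorem3 {k : Type u} [Field k] [IsAlgClosed k] {p : ℕ} [Fact p.Prime] [CharP k p]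
    {r : ℕ} (hr : 0 < r) {X : Scheme.{u}} (f : X ⟶ Spec (.of k))
    [SmoothOfRelativeDimension 1 f] [IsSeparated f] [QuasiCompact f]
    (M : FrobMod.OFModule X (p ^ r)) (hunit : M.IsUnit f) (hfg : M.IsLocallyFG)
    (htf : FrobMod.IsTorsionFree M.psh) :
    ∃ M₀ : M.psh.Submodule,
      IsLeast {N : M.psh.Submodule | M.IsRoot N} M₀ ∧
      (∀ N : M.psh.Submodule, Minimal M.IsRoot N → N = M₀) ∧
      ∀ (x : X) (hx : IsClosed {x}),
        IsLeast {W₀ | FrobMod.IsRoot (M.stalkFrob (pointOfClosedPoint f x hx)) W₀}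
          (M.stalkSubmodule (pointOfClosedPoint f x hx) M₀) := by
  obtain ⟨M₀, hM₀, h⟩ := FrobMod.exists_isRoot_isMinRoot hr hunit hfg
  have hle : ∀ N : M.psh.Submodule, M.IsRoot N → M₀ ≤ N :=
    fun N hN => FrobMod.le_of_isRoot hunit h hN
  refine ⟨M₀, ⟨hM₀, hle⟩, fun N hN => le_antisymm (hN.2 hM₀ (hle N hN.1)) (hle N hN.1),
    fun x hx => ?_⟩
  have hx := FrobMod.isMinRoot_stalkSubmodule (x := pointOfClosedPoint f x hx) hr hunit hfg h
  exact ⟨hx.1, fun W₀ hW₀ => hx.le hW₀⟩
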